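/- **Setting.** Let $N\ge 0$, $r\ge 0$, $0<T<T_i$, and let $\mu_{i,F},\mu_{i,S},\eta_{i,F}<\eta_{i,S}$ be real constants ($1\le i\le N$). Let $\tilde\Sigma=(\tilde\sigma_{i,j})$ be a lower triangular real $2N\times 2N$ matrix such that $$\Sigma=\begin{pmatrix}\Sigma_F&\Sigma_{FS}\\ \Sigma_{FS}^\top&\Sigma_S\end{pmatrix}:=\tilde\Sigma\tilde\Sigma^\top$$ (with $N\times N$ blocks) is positive definite; put $\sigma_{i,F}^2=\Sigma_{i,i}$ and $\sigma_{i,S}^2=\Sigma_{N+i,N+i}$. Let $W=(W_1,\dots,W_{2N})$ be a standard $2N$-dimensional Brownian motion on $[0,T]$ with respect to a filtration $(\mathcal F_t)$ on a probability space (for instance the augmented filtration generated by $W$). Let $F_{t}=(F_{t,i})_i$ and $S_t=(S_{t,i})_i$, $0\le t\le T$, be positive, adapted, almost surely continuous processes with $$dF_{t,i}=F_{t,i}\Big[\Big(\mu_{i,F}+\tfrac{\eta_{i,F}}{T_i-t}Z_{t,i}\Big)dt+\sum_{j=1}^{i}\tilde\sigma_{i,j}\,dW_{t,j}\Big],\qquad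 dS_{t,i}=S_{t,i}\Big[\Big(\mu_{i,S}+\tfrac{\eta_{i,S}}{T_i-t}Z_{t,i}\Big)dt+\sum_{j=1}^{N+i}\tilde\sigma_{N+i,j}\,dW_{t,j}\Big],$$ where $Z_{t,i}:=\log(F_{t,i}/S_{t,i})-r(T_i-t)$. Put $\kappa_i:=\eta_{i,S}-\eta_{i,F}>0$, $m_i:=r+\mu_{i,F}-\mu_{i,S}-\frac12(\sigma_{i,F}^2-\sigma_{i,S}^2)$, and $(\beta_{ij}):=\tilde\Sigma_Z\tilde\Sigma_Z^\top$ with $\tilde\Sigma_Z:=[I_N,-I_N]\tilde\Sigma$. For an integer $M\ge1$, let $t_n:=nT/M$ and, for $1\le n\le M$, $$\phi_{n,i}:=\begin{cases}\dfrac{T_i^{\kappa_i}}{\kappa_i-1}\Big((T_i-t_n)^{1-\kappa_i}-(T_i-t_{n-1})^{1-\kappa_i}\Big),&\kappa_i\ne1,\\[1ex] T_i\ln\dfrac{T_i-t_{n-1}}{T_i-t_n},&\kappa_i=1,\end{cases} \qquad \eta_{ij;n}:=\beta_{ij}\int_{t_{n-1}}^{t_n}\Big(\frac{T_i}{T_i-s}\Big)^{\kappa_i}\Big(\frac{T_j}{T_j-s}\Big)^{\kappa_j}ds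 .$$ **Corollary.** Assume $\eta_{i,S}=0$ for all $i$. Then there are $\mathbb R^{2N}$-valued random variables $e_n=(e_{n,S},e_{n,Z})$, $1\le n\le M$, such that for all $1\le n\le M$, almost surely, for all $i$, $$\begin{aligned} \ln S_{t_n,i}&=\ln S_{t_{n-1},i}+\tfrac TM\big(\mu_{i,S}-\tfrac12\sigma_{i,S}^2\big)+e_{n,S,i},\\ \Big(\tfrac{T_i}{T_i-t_n}\Big)^{\kappa_i}Z_{t_n,i}&=\Big(\tfrac{T_i}{T_i-t_{n-1}}\Big)^{\kappa_i}Z_{t_{n-1},i}+\phi_{n,i}m_i+e_{n,Z,i},\\ \ln F_{t_n,i}&=Z_{t_n,i}+\ln S_{t_n,i}+r(T_i-t_n), \end{aligned}$$ and such that $e_1,\dots,e_M$ are independent, each $e_n$ is (jointly) Gaussian and independent of $\mathcal F_{t_{n-1}}$, and $$\mathbb E(e_n)=0,\quad \mathbb E(e_{n,S}e_{n,S}^\top)=\tfrac TM\Sigma_S,\quad \mathbb E(e_{n,S}e_{n,Z}^\top)=(\Sigma_{FS}^\top-\Sigma_S)\,\mathrm{diag}(\phi_{n,1},\dots,\phi_{n,N}),\quad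 \mathbb E(e_{n,Z}e_{n,Z}^\top)=(\eta_{ij;n})_{i,j}.$$ -/

import Mathlib

open MeasureTheory ProbabilityTheory Filter Set
open scoped ENNReal Topology Matrix

noncomputable section

namespace BasisModel

/-! ### Brownian motion, Itô integral and Itô differentials on a finite horizon

Time is a real number; of a filtration indexed by `ℝ` only the part on `[0, T]` is used. -/

section Ito

variable {Ω : Type*} {mΩ : MeasurableSpace Ω}

/-- `W` is a standard Brownian motion on `[0, T]` with independent coordinates indexed by `ι`,
with respect to the filtration `𝓕`. -/
structure IsBrownianMotion {ι : Type*} [Fintype ι] (P : Measure Ω) (𝓕 : Filtration ℝ mΩ) (T : ℝ)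
    (W : ℝ → Ω → ι → ℝ) : Prop where
  adapted : ∀ t ∈ Icc 0 T, Measurable[𝓕 t] (W t)
  zero : ∀ᵐ ω ∂P, W 0 ω = 0
  continuous : ∀ᵐ ω ∂P, ContinuousOn (fun t ↦ W t ω) (Icc 0 T)
  law_increment : ∀ s t, 0 ≤ s → s ≤ t → t ≤ T →
    HasLaw (fun ω ↦ W t ω - W s ω)
      (Measure.pi fun _ : ι ↦ gaussianReal 0 (t - s).toNNReal) P
  indep_increment : ∀ s t, 0 ≤ s → s ≤ t → t ≤ T →
    Indep (MeasurableSpace.comap (fun ω ↦ W t ω - W s ω) inferInstance) (𝓕 s) P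

/-- A simple predictable process on `[0, T]`: a finite sum of terms `ξ_k 1_{(t_k, t_{k+1}]}`
with `0 ≤ t_0 ≤ t_1 ≤ … ≤ T` and `ξ_k` bounded and `𝓕 (t_k)`-measurable. -/
structure SimpleProcess (𝓕 : Filtration ℝ mΩ) (T : ℝ) where
  size : ℕ
  time : ℕ → ℝ
  time_mono : Monotone time
  time_mem : ∀ k, time k ∈ Icc 0 T
  coef : ℕ → Ω → ℝ
  coef_measurable : ∀ k, Measurable[𝓕 (time k)] (coef k)
  coef_bounded : ∀ k, ∃ C : ℝ, ∀ ω, |coef k ω| ≤ C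

namespace SimpleProcess

variable {𝓕 : Filtration ℝ mΩ} {T : ℝ}

/-- The value of the simple process at time `s`. -/
def val (V : SimpleProcess 𝓕 T) (s : ℝ) (ω : Ω) : ℝ :=
  ∑ k ∈ Finset.range V.size,
    (Ioc (V.time k) (V.time (k + 1))).indicator (fun _ ↦ V.coef k ω) s

/-- The elementary stochastic integral `∫_0^t V dB` of a simple process. -/
def integral (V : SimpleProcess 𝓕 T) (B : ℝ → Ω → ℝ) (t : ℝ) (ω : Ω) : ℝ :=
  ∑ k ∈ Finset.range V.size,
    V.coef k ω * (B (min t (V.time (k + 1))) ω - B (min t (V.time k)) ω)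

end SimpleProcess

/-- `I` is (a version of) the Itô integral process `I_t = ∫_0^t H_s dB_s`, `0 ≤ t ≤ T`, of the
integrand `H` with respect to the one-dimensional Brownian motion `B`: there are simple
predictable processes `V n` such that `∫_0^T |V n - H|² ds → 0` in probability and the elementary
integrals of `V n` converge to `I` in probability, uniformly on `[0, T]`. -/
structure IsItoIntegral (P : Measure Ω) (𝓕 : Filtration ℝ mΩ) (T : ℝ)
    (B H I : ℝ → Ω → ℝ) : Prop where
  aemeasurable : ∀ᵐ ω ∂P, AEMeasurable (fun s ↦ H s ω) (volume.restrict (Icc 0 T))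
  sq_integrable : ∀ᵐ ω ∂P, ∫⁻ s in Icc 0 T, ‖H s ω‖ₑ ^ 2 < ∞
  exists_approx : ∃ V : ℕ → SimpleProcess 𝓕 T,
    (∀ ε : ℝ≥0∞, 0 < ε → Tendsto
      (fun n ↦ P {ω | ε ≤ ∫⁻ s in Icc 0 T, ‖(V n).val s ω - H s ω‖ₑ ^ 2}) atTop (𝓝 0)) ∧
    (∀ ε : ℝ, 0 < ε → Tendsto
      (fun n ↦ P {ω | ∃ t ∈ Icc 0 T, ε ≤ |(V n).integral B t ω - I t ω|}) atTop (𝓝 0))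

/-- The real process `X` satisfies `dX_t = b_t dt + ∑_j σ_{t,j} dW_{t,j}` on `[0, T]`. -/
def HasItoDifferential {ι : Type*} [Fintype ι] (P : Measure Ω) (𝓕 : Filtration ℝ mΩ) (T : ℝ)
    (W : ℝ → Ω → ι → ℝ) (X b : ℝ → Ω → ℝ) (σ : ι → ℝ → Ω → ℝ) : Prop :=
  (∀ᵐ ω ∂P, IntervalIntegrable (fun s ↦ b s ω) volume 0 T) ∧
  ∃ I : ι → ℝ → Ω → ℝ,
    (∀ j, IsItoIntegral P 𝓕 T (fun t ω ↦ W t ω j) (σ j) (I j)) ∧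
    ∀ᵐ ω ∂P, ∀ t ∈ Icc 0 T, X t ω = X 0 ω + (∫ s in (0 : ℝ)..t, b s ω) + ∑ j, I j t ω

end Ito

/-! ### The market -/

/-- The parameters of the market with `N` futures and `N` underlying assets, with the standing
assumptions on them. In the volatility matrix `vol` and the index type of the Brownian motion,
`Sum.inl i` stands for the index `i` (futures) and `Sum.inr i` for the index `N + i`
(underlying assets). -/
structure Params (N : ℕ) where
  /-- interest rate -/
  r : ℝ
  /-- trading horizon -/
  T : ℝ
  /-- expiry dates of the futures -/
  expiry : Fin N → ℝ
  muF : Fin N → ℝ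
  muS : Fin N → ℝ
  etaF : Fin N → ℝ
  etaS : Fin N → ℝ
  vol : Matrix (Fin N ⊕ Fin N) (Fin N ⊕ Fin N) ℝ
  r_nonneg : 0 ≤ r
  T_pos : 0 < T
  T_lt_expiry : ∀ i, T < expiry i
  etaF_lt_etaS : ∀ i, etaF i < etaS i
  vol_lowerTriangular : ∀ a b, toLex a < toLex b → vol a b = 0
  cov_posDef : (vol * volᵀ).PosDef

namespace Params

variable {N : ℕ} (p : Params N)

/-- The instantaneous covariance matrix `Σ`. -/
def cov : Matrix (Fin N ⊕ Fin N) (Fin N ⊕ Fin N) ℝ := p.vol * p.volᵀ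

/-- The block `Σ_FS` of `Σ`. -/
def covFS : Matrix (Fin N) (Fin N) ℝ := p.cov.toBlocks₁₂

/-- The block `Σ_S` of `Σ`. -/
def covS : Matrix (Fin N) (Fin N) ℝ := p.cov.toBlocks₂₂

/-- The volatility `σ_{i,F}` of the `i`-th futures. -/
def volF (i : Fin N) : ℝ := √(p.cov (.inl i) (.inl i))

/-- The volatility `σ_{i,S}` of the `i`-th underlying asset. -/
def volS (i : Fin N) : ℝ := √(p.cov (.inr i) (.inr i))

/-- The volatility matrix `[I, -I] * vol` of the log-basis. -/
def volZ : Matrix (Fin N) (Fin N ⊕ Fin N) ℝ :=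
  Matrix.fromCols (1 : Matrix (Fin N) (Fin N) ℝ) (-1) * p.vol

/-- The covariance matrix `Σ_Z = (β_ij)` of the log-basis. -/
def covZ : Matrix (Fin N) (Fin N) ℝ := p.volZ * p.volZᵀ

def kappa (i : Fin N) : ℝ := p.etaS i - p.etaF i

def m (i : Fin N) : ℝ :=
  p.r + p.muF i - p.muS i - 1 / 2 * (p.volF i ^ 2 - p.volS i ^ 2)

/-- The drift `μ_{i,S} - σ_{i,S}² / 2` of the `i`-th log-price. -/
def logDriftS (i : Fin N) : ℝ := p.muS i - 1 / 2 * p.volS i ^ 2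

/-- The scaling factor `(T_i / (T_i - t)) ^ κ_i`. -/
def scale (i : Fin N) (t : ℝ) : ℝ := (p.expiry i / (p.expiry i - t)) ^ p.kappa i

/-- The grid point `n T / M`. -/
def grid (M n : ℕ) : ℝ := n * p.T / M

/-- The coefficient `φ_{n,i}` for the step from `(n - 1) T / M` to `n T / M`, `1 ≤ n ≤ M`. -/
def phi (M n : ℕ) (i : Fin N) : ℝ :=
  if p.kappa i = 1 then
    p.expiry i * Real.log
      ((p.expiry i - p.grid M (n - 1)) / (p.expiry i - p.grid M n))
  else
    p.expiry i ^ p.kappa i / (p.kappa i - 1) *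
      ((p.expiry i - p.grid M n) ^ (1 - p.kappa i)
        - (p.expiry i - p.grid M (n - 1)) ^ (1 - p.kappa i))

/-- The covariance `η_{ij;n}` of the errors of the log-basis in the step from `(n - 1) T / M` to
`n T / M`, `1 ≤ n ≤ M`. -/
def etaCov (M n : ℕ) : Matrix (Fin N) (Fin N) ℝ := Matrix.of fun i j ↦
  p.covZ i j * ∫ s in p.grid M (n - 1)..p.grid M n, p.scale i s * p.scale j s

variable {Ω : Type*} {mΩ : MeasurableSpace Ω}

/-- The log-basis `Z_{t,i} = log (F_{t,i} / S_{t,i}) - r (T_i - t)`. -/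
def logBasis (F S : ℝ → Ω → Fin N → ℝ) (t : ℝ) (ω : Ω) (i : Fin N) : ℝ :=
  Real.log (F t ω i / S t ω i) - p.r * (p.expiry i - t)

/-- `F` and `S` are positive, adapted, continuous price processes on `[0, T]` that solve the
stochastic differential equations of the market driven by the Brownian motion `W`. As `vol` is
lower triangular, the sums over all Brownian coordinates reduce to the sums up to `i` for the
futures and up to `N + i` for the underlying assets. -/
structure IsMarket (P : Measure Ω) (𝓕 : Filtration ℝ mΩ) (W : ℝ → Ω → Fin N ⊕ Fin N → ℝ)
    (F S : ℝ → Ω → Fin N → ℝ) : Prop where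
  adapted_F : ∀ t ∈ Icc 0 p.T, Measurable[𝓕 t] (F t)
  adapted_S : ∀ t ∈ Icc 0 p.T, Measurable[𝓕 t] (S t)
  continuous_F : ∀ᵐ ω ∂P, ContinuousOn (fun t ↦ F t ω) (Icc 0 p.T)
  continuous_S : ∀ᵐ ω ∂P, ContinuousOn (fun t ↦ S t ω) (Icc 0 p.T)
  pos_F : ∀ᵐ ω ∂P, ∀ t ∈ Icc 0 p.T, ∀ i, 0 < F t ω i
  pos_S : ∀ᵐ ω ∂P, ∀ t ∈ Icc 0 p.T, ∀ i, 0 < S t ω i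
  sde_F : ∀ i, HasItoDifferential P 𝓕 p.T W (fun t ω ↦ F t ω i)
    (fun t ω ↦ F t ω i *
      (p.muF i + p.etaF i / (p.expiry i - t) * p.logBasis F S t ω i))
    (fun j t ω ↦ F t ω i * p.vol (.inl i) j)
  sde_S : ∀ i, HasItoDifferential P 𝓕 p.T W (fun t ω ↦ S t ω i)
    (fun t ω ↦ S t ω i *
      (p.muS i + p.etaS i / (p.expiry i - t) * p.logBasis F S t ω i))
    (fun j t ω ↦ S t ω i * p.vol (.inr i) j)

end Params

end BasisModel

end

/-! When $\eta_{i,S}=0$, each $\ln S_i$ is a Brownian motion with drift, and the log-basis solves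
the linear equation $dZ_i=(m_i-\frac{\kappa_i}{T_i-t}Z_i)\,dt+(\tilde\Sigma_Z\,dW)_i$. The scaling
factor $\rho_i(t)=(T_i/(T_i-t))^{\kappa_i}$ satisfies $\rho_i'=\frac{\kappa_i}{T_i-t}\rho_i$, so it
is an integrating factor: $d(\rho_iZ_i)=\rho_im_i\,dt+\rho_i(\tilde\Sigma_Z\,dW)_i$. Over one grid
step the drift contributes $\phi_{n,i}m_i$ (`integral_scale`), and the errors are Wiener integrals
of deterministic integrands. These are jointly Gaussian and independent of the past, with
covariances given by Itô's isometry (`wiener_gaussian`); independence across steps follows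
(`iIndepFun_of_indep_past`).

The stochastic calculus is done by hand. Itô's formula is needed only for $\ln X$ with
$dX=X(b\,dt+v\cdot dW)$ (`HasItoDifferential.log_eq`). Along uniform grids, $\ln X_t-\ln X_0$ is the
sum of $R_k-R_k^2/2$ up to a negligible remainder, $R_k$ being the relative increments. The noise in
$R_k$ is $v\cdot\Delta W$ plus an error. Once the stochastic integral is replaced by elementary
integrals of simple processes $V$, this error is a martingale transform with integrand
$V/X_{\tau_k}-v$, whose square integral tends to zero almost surely. The Lenglart-type bound
`measure_transform_le` turns this into convergence in probability of the sum of the errors and of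
the sum of their squares. Since $\sum(v\cdot\Delta W)^2\to|v|^2t$ in probability as well, a common
subsequence converges almost surely, and the pathwise lemma `log_eq_of_unifGrid` concludes.

The Wiener integrands are $C^1$ in time, so their Riemann sums converge along every continuous path,
by integration by parts. The same expression appears in the pathwise variation of constants
`mul_sub_mul_of_linear`, which identifies the errors; their characteristic functions are limits of
those of the Riemann sums. -/

namespace BasisModel

/-! ### Uniform grids and Riemann sums -/

section Grid

/-- The `k`-th point of the uniform grid with `n` steps on `[a, b]`. -/
noncomputable def unifGrid (a b : ℝ) (n k : ℕ) : ℝ := a + k / n * (b - a)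

variable {a b : ℝ} {n : ℕ}

@[simp] lemma unifGrid_zero : unifGrid a b n 0 = a := by simp [unifGrid]

lemma unifGrid_last (hn : 0 < n) : unifGrid a b n n = b := by
  have : (n : ℝ) ≠ 0 := by positivity
  simp [unifGrid, this]

lemma unifGrid_monotone (hab : a ≤ b) : Monotone (unifGrid a b n) := by
  intro k l hkl
  have : (k : ℝ) ≤ l := by exact_mod_cast hkl
  have : 0 ≤ b - a := by linarith
  unfold unifGrid
  gcongr

lemma unifGrid_succ_sub (k : ℕ) :
    unifGrid a b n (k + 1) - unifGrid a b n k = (b - a) / n := by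
  unfold unifGrid; push_cast; ring

lemma unifGrid_mem (hab : a ≤ b) (hn : 0 < n) {k : ℕ} (hk : k ≤ n) :
    unifGrid a b n k ∈ Icc a b :=
  ⟨by simpa using unifGrid_monotone (n := n) hab (Nat.zero_le k),
    by simpa [unifGrid_last hn] using unifGrid_monotone (n := n) hab hk⟩

lemma unifGrid_Icc_subset (hab : a ≤ b) {k : ℕ} (hk : k < n) :
    Icc (unifGrid a b n k) (unifGrid a b n (k + 1)) ⊆ Icc a b :=
  Icc_subset_Icc (unifGrid_mem hab (by omega) hk.le).1 (unifGrid_mem hab (by omega) hk).2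

/-- A continuous function oscillates little on the cells of a fine uniform grid. -/
lemma eventually_unifGrid_osc (hab : a ≤ b) {f : ℝ → ℝ} (hf : ContinuousOn f (Icc a b))
    {ε : ℝ} (hε : 0 < ε) :
    ∀ᶠ n in atTop, ∀ k < n, ∀ s ∈ Icc (unifGrid a b n k) (unifGrid a b n (k + 1)),
      |f s - f (unifGrid a b n k)| ≤ ε := by
  have hu := isCompact_Icc.uniformContinuousOn_of_continuous hf
  obtain ⟨δ, hδ, h⟩ := Metric.uniformContinuousOn_iff.1 hu ε hε
  have h1 : Tendsto (fun n : ℕ ↦ (b - a) / (n : ℝ)) atTop (𝓝 0) :=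
    tendsto_const_div_atTop_nhds_zero_nat _
  filter_upwards [h1.eventually (gt_mem_nhds hδ)] with n hn k hk s hs
  have h2 := unifGrid_succ_sub (a := a) (b := b) (n := n) k
  refine (h s (unifGrid_Icc_subset hab hk hs) _ (unifGrid_mem hab (by omega) hk.le) ?_).le
  rw [Real.dist_eq, abs_of_nonneg (by linarith [hs.1])]
  linarith [hs.2]

lemma eventually_unifGrid_osc_right (hab : a ≤ b) {f : ℝ → ℝ} (hf : ContinuousOn f (Icc a b))
    {ε : ℝ} (hε : 0 < ε) :
    ∀ᶠ n in atTop, ∀ k < n, ∀ s ∈ Icc (unifGrid a b n k) (unifGrid a b n (k + 1)),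
      |f s - f (unifGrid a b n (k + 1))| ≤ ε := by
  filter_upwards [eventually_unifGrid_osc hab hf (half_pos hε)] with n hn k hk s hs
  have h1 := hn k hk s hs
  have h2 := hn k hk _ (right_mem_Icc.2 (unifGrid_monotone hab k.le_succ))
  rw [abs_le] at *
  constructor <;> linarith

lemma sum_integral_unifGrid (hab : a ≤ b) (hn : 0 < n) {f : ℝ → ℝ}
    (hf : IntervalIntegrable f volume a b) :
    ∑ k ∈ Finset.range n, ∫ s in unifGrid a b n k..unifGrid a b n (k + 1), f s
      = ∫ s in a..b, f s := by
  rw [intervalIntegral.sum_integral_adjacent_intervals, unifGrid_zero, unifGrid_last hn]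
  intro k hk
  refine hf.mono_set ?_
  rw [uIcc_of_le hab, uIcc_of_le (unifGrid_monotone hab k.le_succ)]
  exact unifGrid_Icc_subset hab hk

/-- Sums of integrals over the cells of uniform grids vanish in the limit if one factor of the
integrand vanishes uniformly. -/
lemma tendsto_sum_integral_unifGrid (hab : a ≤ b) {q : ℝ → ℝ} (hq : ContinuousOn q (Icc a b))
    {φ : ℕ → ℕ → ℝ → ℝ}
    (hφ : ∀ ε > 0, ∀ᶠ n in atTop, ∀ k < n,
      ∀ s ∈ Icc (unifGrid a b n k) (unifGrid a b n (k + 1)), |φ n k s| ≤ ε) :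
    Tendsto (fun n ↦ ∑ k ∈ Finset.range n,
      ∫ s in unifGrid a b n k..unifGrid a b n (k + 1), φ n k s * q s) atTop (𝓝 0) := by
  obtain ⟨C, hC⟩ := isCompact_Icc.exists_bound_of_continuousOn hq
  have hC0 : 0 ≤ C := (norm_nonneg _).trans (hC a (left_mem_Icc.2 hab))
  rw [Metric.tendsto_atTop']
  intro ε hε
  -- The `+ 1` avoids division by zero and makes the final estimate strict.
  have hη : 0 < ε / (C * (b - a) + 1) := by
    have : 0 ≤ b - a := by linarith
    positivity
  obtain ⟨n₀, hn₀⟩ := eventually_atTop.1 (hφ _ hη)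
  refine ⟨n₀, fun n hn ↦ ?_⟩
  have hcell : ∀ k ∈ Finset.range n,
      |∫ s in unifGrid a b n k..unifGrid a b n (k + 1), φ n k s * q s|
        ≤ ε / (C * (b - a) + 1) * C * ((b - a) / n) := by
    intro k hk
    rw [← unifGrid_succ_sub (n := n) k]
    have hm := unifGrid_monotone (n := n) hab k.le_succ
    have := intervalIntegral.norm_integral_le_of_norm_le_const (a := unifGrid a b n k)
      (b := unifGrid a b n (k + 1)) (f := fun s ↦ φ n k s * q s)
      (C := ε / (C * (b - a) + 1) * C) ?_
    · rwa [abs_of_nonneg (sub_nonneg.2 hm)] at this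
    · intro s hs
      rw [uIoc_of_le hm] at hs
      have hs' := Ioc_subset_Icc_self hs
      rw [norm_mul]
      exact mul_le_mul (hn₀ n hn.le k (Finset.mem_range.1 hk) s hs')
        (hC s (unifGrid_Icc_subset hab (Finset.mem_range.1 hk) hs')) (norm_nonneg _) hη.le
  rw [Real.dist_eq, sub_zero]
  have hn' : (0 : ℝ) < n := by
    have : 0 < n := by omega
    exact_mod_cast this
  calc |∑ k ∈ Finset.range n, ∫ s in unifGrid a b n k..unifGrid a b n (k + 1), φ n k s * q s|
      ≤ ∑ k ∈ Finset.range n, ε / (C * (b - a) + 1) * C * ((b - a) / n) :=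
        (Finset.abs_sum_le_sum_abs _ _).trans (Finset.sum_le_sum hcell)
    _ = ε * ((C * (b - a)) / (C * (b - a) + 1)) := by
        rw [Finset.sum_const, Finset.card_range, nsmul_eq_mul]; field_simp
    _ < ε * 1 := by
        have : 0 ≤ b - a := by linarith
        refine mul_lt_mul_of_pos_left ?_ hε
        rw [div_lt_one (by positivity)]
        linarith
    _ = ε := mul_one _

/-- Convergence of left Riemann sums on uniform grids. -/
lemma tendsto_riemann_sum (hab : a ≤ b) {f : ℝ → ℝ} (hf : ContinuousOn f (Icc a b)) :
    Tendsto (fun n : ℕ ↦ ∑ k ∈ Finset.range n, f (unifGrid a b n k) * ((b - a) / n)) atTop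
      (𝓝 (∫ s in a..b, f s)) := by
  have hi : IntervalIntegrable f volume a b := by
    rw [← uIcc_of_le hab] at hf; exact hf.intervalIntegrable
  -- The integral minus the left sum is the sum of the cell integrals of `f s - f (unifGrid a b n
  -- k)`.
  have h := tendsto_sum_integral_unifGrid hab (q := fun _ ↦ 1) continuousOn_const
    (φ := fun n k s ↦ f s - f (unifGrid a b n k))
    (fun ε hε ↦ eventually_unifGrid_osc hab hf hε)
  have h2 : Tendsto (fun n : ℕ ↦ (∫ s in a..b, f s) - ∑ k ∈ Finset.range n,
      ∫ s in unifGrid a b n k..unifGrid a b n (k + 1), (f s - f (unifGrid a b n k)) * 1)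
      atTop (𝓝 ((∫ s in a..b, f s) - 0)) := tendsto_const_nhds.sub h
  rw [sub_zero] at h2
  refine h2.congr' ?_
  filter_upwards [eventually_gt_atTop 0] with n hn
  rw [← sum_integral_unifGrid hab hn hi, ← Finset.sum_sub_distrib]
  refine Finset.sum_congr rfl fun k hk ↦ ?_
  have hik : IntervalIntegrable f volume (unifGrid a b n k) (unifGrid a b n (k + 1)) := by
    refine hi.mono_set ?_
    rw [uIcc_of_le hab, uIcc_of_le (unifGrid_monotone hab k.le_succ)]
    exact unifGrid_Icc_subset hab (Finset.mem_range.1 hk)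
  simp only [mul_one]
  rw [intervalIntegral.integral_sub hik (by simp), intervalIntegral.integral_const,
    unifGrid_succ_sub, smul_eq_mul]
  ring

/-- Left Riemann–Stieltjes sums of a continuously differentiable integrand against a continuous
path converge to the integral defined by integration by parts. -/
lemma tendsto_riemann_stieltjes_sum (hab : a ≤ b) {h h' G : ℝ → ℝ}
    (hh : ∀ s ∈ Icc a b, HasDerivAt h (h' s) s) (hh' : ContinuousOn h' (Icc a b))
    (hG : ContinuousOn G (Icc a b)) :
    Tendsto (fun n : ℕ ↦ ∑ k ∈ Finset.range n,
        h (unifGrid a b n k) * (G (unifGrid a b n (k + 1)) - G (unifGrid a b n k))) atTop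
      (𝓝 (h b * G b - h a * G a - ∫ s in a..b, G s * h' s)) := by
  have hi : IntervalIntegrable (fun s ↦ G s * h' s) volume a b := by
    have := hG.mul hh'
    rw [← uIcc_of_le hab] at this; exact this.intervalIntegrable
  -- Summation by parts, $h_k\,\Delta G_k=\Delta(hG)_k-G_{k+1}\,\Delta h_k$, puts `G` at the right
  -- endpoint of each cell.
  have h0 := tendsto_sum_integral_unifGrid hab hh'
    (φ := fun n k s ↦ G s - G (unifGrid a b n (k + 1)))
    (fun ε hε ↦ eventually_unifGrid_osc_right hab hG hε)
  have h2 := (tendsto_const_nhds (x := h b * G b - h a * G a - ∫ s in a..b, G s * h' s)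
    (f := (atTop : Filter ℕ))).add h0
  rw [add_zero] at h2
  refine h2.congr' ?_
  filter_upwards [eventually_gt_atTop 0] with n hn
  have htel : ∀ u : ℕ → ℝ, ∑ k ∈ Finset.range n, (u (k + 1) - u k) = u n - u 0 :=
    fun u ↦ Finset.sum_range_sub u n
  have h3 := htel fun k ↦ h (unifGrid a b n k) * G (unifGrid a b n k)
  simp only [unifGrid_zero, unifGrid_last hn] at h3
  rw [← sum_integral_unifGrid hab hn hi, ← h3, sub_add, ← Finset.sum_sub_distrib,
    ← Finset.sum_sub_distrib]
  refine Finset.sum_congr rfl fun k hk ↦ ?_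
  have hm := unifGrid_monotone (n := n) hab k.le_succ
  have hsub : uIcc (unifGrid a b n k) (unifGrid a b n (k + 1)) ⊆ Icc a b := by
    rw [uIcc_of_le hm]
    exact unifGrid_Icc_subset hab (Finset.mem_range.1 hk)
  have hi1 : IntervalIntegrable (fun s ↦ G s * h' s) volume (unifGrid a b n k)
      (unifGrid a b n (k + 1)) := ((hG.mul hh').mono hsub).intervalIntegrable
  have hi2 : IntervalIntegrable h' volume (unifGrid a b n k)
      (unifGrid a b n (k + 1)) := (hh'.mono hsub).intervalIntegrable
  have hftc := intervalIntegral.integral_eq_sub_of_hasDerivAt (fun s hs ↦ hh s (hsub hs)) hi2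
  simp only [sub_mul]
  rw [intervalIntegral.integral_sub hi1 (hi2.const_mul _), intervalIntegral.integral_const_mul,
    hftc]
  ring

end Grid

/-! ### A pathwise second-order expansion of the logarithm -/

/-- The Taylor remainder of order two is at most $|y|^3/(1-|y|)$, and $1-|y|\ge\frac12$. The bound
is written as a small factor times $y^2$ so that it can be summed against a quadratic variation. -/
lemma abs_log_one_add_sub_le {y : ℝ} (hy : |y| ≤ 1 / 2) :
    |Real.log (1 + y) - y + y ^ 2 / 2| ≤ 2 * |y| * y ^ 2 := by
  have h := Real.abs_log_sub_add_sum_range_le (x := -y) (by rw [abs_neg]; linarith) 2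
  simp only [Finset.sum_range_succ, Finset.sum_range_zero, abs_neg] at h
  have e : Real.log (1 + y) - y + y ^ 2 / 2 = 0 + (-y) ^ (0 + 1) / ((0 : ℕ) + 1)
      + (-y) ^ (1 + 1) / ((1 : ℕ) + 1) + Real.log (1 - -y) := by
    push_cast; rw [sub_neg_eq_add]; ring
  rw [e]
  refine h.trans ?_
  rw [div_le_iff₀ (by linarith), ← sq_abs y]
  have h3 := mul_nonneg (pow_nonneg (abs_nonneg y) 3) (by linarith : 0 ≤ 1 - 2 * |y|)
  rw [← sub_nonneg]
  convert h3 using 1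
  ring

/-- Cauchy–Schwarz: a part with vanishing quadratic variation has vanishing covariation with a part
of convergent quadratic variation. -/
lemma tendsto_sum_mul_zero {ι : Type*} {l : Filter ι} {ν : ι → ℕ} {g e : ι → ℕ → ℝ} {v : ℝ}
    (hg : Tendsto (fun i ↦ ∑ k ∈ Finset.range (ν i), g i k ^ 2) l (𝓝 v))
    (he : Tendsto (fun i ↦ ∑ k ∈ Finset.range (ν i), e i k ^ 2) l (𝓝 0)) :
    Tendsto (fun i ↦ ∑ k ∈ Finset.range (ν i), g i k * e i k) l (𝓝 0) := by
  have h1 := (hg.mul he).sqrt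
  rw [mul_zero, Real.sqrt_zero] at h1
  exact squeeze_zero_norm (fun i ↦ Real.abs_le_sqrt (Finset.sum_mul_sq_le_sq_mul_sq _ _ _)) h1

/-- If the relative increments of a positive continuous path `x` over uniform grids decompose into
a drift part, a part `g` with quadratic variation `v`, and a part `d` that vanishes in the limit
together with its quadratic variation, then `log x` satisfies Itô's formula. -/
lemma log_eq_of_unifGrid {x b M : ℝ → ℝ} {t : ℝ} (ht : 0 ≤ t) (hx : ContinuousOn x (Icc 0 t))
    (hpos : ∀ s ∈ Icc 0 t, 0 < x s) (hb : ContinuousOn b (Icc 0 t))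
    (hM : ∀ s ∈ Icc 0 t, x s = x 0 + (∫ r in (0 : ℝ)..s, x r * b r) + M s)
    {ν : ℕ → ℕ} (hν : Tendsto ν atTop atTop) {g d : ℕ → ℕ → ℝ} {G v : ℝ}
    (hgd : ∀ᶠ i in atTop, ∀ k < ν i,
      (M (unifGrid 0 t (ν i) (k + 1)) - M (unifGrid 0 t (ν i) k)) / x (unifGrid 0 t (ν i) k)
        = g i k + d i k)
    (hg : Tendsto (fun i ↦ ∑ k ∈ Finset.range (ν i), g i k) atTop (𝓝 G))
    (hg2 : Tendsto (fun i ↦ ∑ k ∈ Finset.range (ν i), g i k ^ 2) atTop (𝓝 v))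
    (hd : Tendsto (fun i ↦ ∑ k ∈ Finset.range (ν i), d i k) atTop (𝓝 0))
    (hd2 : Tendsto (fun i ↦ ∑ k ∈ Finset.range (ν i), d i k ^ 2) atTop (𝓝 0)) :
    Real.log (x t) = Real.log (x 0) + (∫ r in (0 : ℝ)..t, b r) + G - v / 2 := by
  obtain ⟨s₀, hs₀, hmin⟩ := isCompact_Icc.exists_isMinOn (nonempty_Icc.2 ht) hx
  set m := x s₀ with hm
  have hm0 : 0 < m := hpos s₀ hs₀
  have hmx : ∀ s ∈ Icc 0 t, m ≤ x s := fun s hs ↦ hmin hs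
  have hxb := hx.mul hb
  obtain ⟨C, hC⟩ := isCompact_Icc.exists_bound_of_continuousOn hxb
  have hC0 : 0 ≤ C := (norm_nonneg _).trans (hC 0 (left_mem_Icc.2 ht))
  have hixb : ∀ c ∈ Icc 0 t, ∀ e ∈ Icc 0 t, IntervalIntegrable (fun r ↦ x r * b r) volume c e :=
    fun c hc e he ↦ (hxb.mono (uIcc_subset_Icc hc he)).intervalIntegrable
  have hib : ∀ c ∈ Icc 0 t, ∀ e ∈ Icc 0 t, IntervalIntegrable b volume c e :=
    fun c hc e he ↦ (hb.mono (uIcc_subset_Icc hc he)).intervalIntegrable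
  have h00 : (0 : ℝ) ∈ Icc 0 t := left_mem_Icc.2 ht
  have htt : t ∈ Icc 0 t := right_mem_Icc.2 ht
  set τ : ℕ → ℕ → ℝ := unifGrid 0 t with hτ
  have hτm : ∀ {n k}, k < n → τ n k ∈ Icc 0 t := fun h ↦ unifGrid_mem ht (by omega) h.le
  have hτm' : ∀ {n k}, k < n → τ n (k + 1) ∈ Icc 0 t := fun h ↦ unifGrid_mem ht (by omega) h
  set a : ℕ → ℕ → ℝ := fun n k ↦ (∫ r in τ n k..τ n (k + 1), x r * b r) / x (τ n k) with ha
  set R : ℕ → ℕ → ℝ := fun n k ↦ x (τ n (k + 1)) / x (τ n k) - 1 with hR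
  have hRosc : ∀ ε > 0, ∀ᶠ n in atTop, ∀ k < n, ∀ s ∈ Icc (τ n k) (τ n (k + 1)),
      |x s / x (τ n k) - 1| ≤ ε := by
    intro ε hε
    filter_upwards [eventually_unifGrid_osc ht hx (mul_pos hε hm0)] with n hn k hk s hs
    have h1 := hpos _ (hτm hk)
    rw [div_sub_one h1.ne', abs_div, abs_of_pos h1, div_le_iff₀ h1]
    exact (hn k hk s hs).trans (by gcongr; exact hmx _ (hτm hk))
  -- the drift part
  have hsa : Tendsto (fun n ↦ ∑ k ∈ Finset.range n, a n k) atTop (𝓝 (∫ r in (0 : ℝ)..t, b r)) := by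
    have h1 := (tendsto_sum_integral_unifGrid ht hb
      (φ := fun n k s ↦ x s / x (τ n k) - 1) hRosc).add_const (∫ r in (0 : ℝ)..t, b r)
    rw [zero_add] at h1
    refine h1.congr' ?_
    filter_upwards [eventually_gt_atTop 0] with n hn
    rw [← sum_integral_unifGrid ht hn (hib 0 h00 t htt), ← Finset.sum_add_distrib]
    refine Finset.sum_congr rfl fun k hk ↦ ?_
    have hk' := Finset.mem_range.1 hk
    rw [← intervalIntegral.integral_add _ (hib _ (hτm hk') _ (hτm' hk')), ha]
    · simp only
      rw [← intervalIntegral.integral_div]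
      congr 1; ext r; ring
    · have : (fun r ↦ (x r / x (τ n k) - 1) * b r)
          = fun r ↦ (x r * b r) / x (τ n k) - b r := by ext r; ring
      rw [this]
      exact ((hixb _ (hτm hk') _ (hτm' hk')).div_const _).sub (hib _ (hτm hk') _ (hτm' hk'))
  -- There are $n$ terms, each the square of a drift increment of size $O(1/n)$.
  have hsa2 : Tendsto (fun n ↦ ∑ k ∈ Finset.range n, a n k ^ 2) atTop (𝓝 0) := by
    have h1 : Tendsto (fun n : ℕ ↦ (C / m * t) ^ 2 / n) atTop (𝓝 0) :=
      tendsto_const_div_atTop_nhds_zero_nat _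
    refine squeeze_zero (fun n ↦ Finset.sum_nonneg fun k _ ↦ sq_nonneg _) (fun n ↦ ?_) h1
    have h2 : ∀ k ∈ Finset.range n, a n k ^ 2 ≤ (C / m * t / n) ^ 2 := by
      intro k hk
      have hk' := Finset.mem_range.1 hk
      have hmono := unifGrid_monotone (n := n) ht k.le_succ
      have h3 := intervalIntegral.norm_integral_le_of_norm_le_const (a := τ n k)
        (b := τ n (k + 1)) (f := fun r ↦ x r * b r) (C := C) ?_
      · rw [unifGrid_succ_sub, sub_zero, abs_of_nonneg (by positivity)] at h3
        rw [← sq_abs]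
        refine pow_le_pow_left₀ (abs_nonneg _) ?_ 2
        have h4 := hpos _ (hτm hk')
        rw [ha]; simp only
        rw [abs_div, abs_of_pos h4]
        calc _ ≤ C * (t / n) / m := div_le_div₀ (by positivity) h3 hm0 (hmx _ (hτm hk'))
          _ = _ := by ring
      · intro r hr
        rw [uIoc_of_le hmono] at hr
        exact hC r (unifGrid_Icc_subset ht hk' (Ioc_subset_Icc_self hr))
    refine (Finset.sum_le_sum h2).trans ?_
    rw [Finset.sum_const, Finset.card_range, nsmul_eq_mul]
    rcases Nat.eq_zero_or_pos n with rfl | hn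
    · simp
    · have : (0 : ℝ) < n := by exact_mod_cast hn
      apply le_of_eq; field_simp
  -- decomposition of the relative increments
  have hRdec : ∀ᶠ i in atTop, ∀ k < ν i, R (ν i) k = g i k + (a (ν i) k + d i k) := by
    filter_upwards [hgd] with i hi k hk
    have h1 := hi k hk
    have h2 := hM _ (hτm hk)
    have h3 := hM _ (hτm' hk)
    have h4 := hpos _ (hτm hk)
    have h5 := intervalIntegral.integral_add_adjacent_intervals
      (hixb 0 h00 _ (hτm hk)) (hixb _ (hτm hk) _ (hτm' hk))
    rw [add_left_comm, ← h1]
    simp only [ha, hR]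
    rw [div_sub_one h4.ne', ← add_div]
    congr 1
    rw [h3, h2, ← h5]
    ring
  have hse2 : Tendsto (fun i ↦ ∑ k ∈ Finset.range (ν i), (a (ν i) k + d i k) ^ 2) atTop (𝓝 0) := by
    have h1 := ((hsa2.comp hν).add hd2).const_mul 2
    rw [add_zero, mul_zero] at h1
    refine squeeze_zero (fun n ↦ Finset.sum_nonneg fun k _ ↦ sq_nonneg _) (fun i ↦ ?_) h1
    simp only [Function.comp_def]
    rw [← Finset.sum_add_distrib, Finset.mul_sum]
    exact Finset.sum_le_sum fun k _ ↦ by nlinarith [sq_nonneg (a (ν i) k - d i k)]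
  -- Only `g` contributes to the quadratic variation: in $(g+e)^2$ with $e=a+d$, the terms $2ge$ and
  -- $e^2$ vanish in the limit.
  have hsR2 : Tendsto (fun i ↦ ∑ k ∈ Finset.range (ν i), R (ν i) k ^ 2) atTop (𝓝 v) := by
    have h1 := (hg2.add ((tendsto_sum_mul_zero hg2 hse2).const_mul 2)).add hse2
    rw [mul_zero, add_zero, add_zero] at h1
    refine h1.congr' ?_
    filter_upwards [hRdec] with i hi
    rw [Finset.mul_sum, ← Finset.sum_add_distrib, ← Finset.sum_add_distrib]
    refine Finset.sum_congr rfl fun k hk ↦ ?_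
    rw [hi k (Finset.mem_range.1 hk)]; ring
  have hsR : Tendsto (fun i ↦ ∑ k ∈ Finset.range (ν i), R (ν i) k) atTop
      (𝓝 ((∫ r in (0 : ℝ)..t, b r) + G)) := by
    have h1 := (hg.add ((hsa.comp hν).add hd))
    rw [add_zero, add_comm] at h1
    refine h1.congr' ?_
    filter_upwards [hRdec] with i hi
    simp only [Function.comp_def]
    rw [← Finset.sum_add_distrib, ← Finset.sum_add_distrib]
    exact Finset.sum_congr rfl fun k hk ↦ (hi k (Finset.mem_range.1 hk)).symm
  -- the remainder
  have hrem : Tendsto (fun i ↦ ∑ k ∈ Finset.range (ν i),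
      (Real.log (1 + R (ν i) k) - R (ν i) k + R (ν i) k ^ 2 / 2)) atTop (𝓝 0) := by
    rw [Metric.tendsto_nhds]
    intro ε hε
    have hv : 0 ≤ v := ge_of_tendsto' hg2 fun i ↦ Finset.sum_nonneg fun k _ ↦ sq_nonneg _
    -- The bound `1 / 2` admits the logarithmic expansion. The other bound makes the remainder at
    -- most $\frac{\varepsilon}{v+1}\sum R_k^2$, while the sum of squares is eventually below $v+1$.
    have hδ : 0 < min (1 / 2) (ε / (2 * (v + 1))) := by positivity
    filter_upwards [hν.eventually (hRosc _ hδ), hsR2.eventually (gt_mem_nhds (lt_add_one v)),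
      hν.eventually (eventually_gt_atTop 0)] with i h1 h2 h3
    rw [Real.dist_eq, sub_zero]
    have h4 : ∀ k ∈ Finset.range (ν i),
        |Real.log (1 + R (ν i) k) - R (ν i) k + R (ν i) k ^ 2 / 2|
          ≤ ε / (v + 1) * R (ν i) k ^ 2 := by
      intro k hk
      have h5 := h1 k (Finset.mem_range.1 hk) _ (right_mem_Icc.2 (unifGrid_monotone ht k.le_succ))
      refine (abs_log_one_add_sub_le (h5.trans (min_le_left _ _))).trans ?_
      refine mul_le_mul_of_nonneg_right ?_ (sq_nonneg _)
      have h6 := h5.trans (min_le_right _ _)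
      calc 2 * |R (ν i) k| ≤ 2 * (ε / (2 * (v + 1))) := by gcongr
        _ = ε / (v + 1) := by field_simp
    calc _ ≤ ∑ k ∈ Finset.range (ν i), ε / (v + 1) * R (ν i) k ^ 2 :=
          (Finset.abs_sum_le_sum_abs _ _).trans (Finset.sum_le_sum h4)
      _ = ε / (v + 1) * ∑ k ∈ Finset.range (ν i), R (ν i) k ^ 2 := by rw [Finset.mul_sum]
      _ < ε / (v + 1) * (v + 1) := by gcongr
      _ = ε := by field_simp
  have hlim := (hrem.add hsR).sub (hsR2.div_const 2)
  -- The logarithmic increments telescope, so the convergent right-hand side is eventually constant.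
  have hconst : ∀ᶠ i in atTop, Real.log (x t) - Real.log (x 0)
      = (∑ k ∈ Finset.range (ν i), (Real.log (1 + R (ν i) k) - R (ν i) k + R (ν i) k ^ 2 / 2))
        + (∑ k ∈ Finset.range (ν i), R (ν i) k) - (∑ k ∈ Finset.range (ν i), R (ν i) k ^ 2) / 2 := by
    filter_upwards [hν.eventually (eventually_gt_atTop 0)] with i hi
    have h1 := Finset.sum_range_sub (fun k ↦ Real.log (x (τ (ν i) k))) (ν i)
    simp only [hτ, unifGrid_zero, unifGrid_last hi] at h1
    rw [← h1, Finset.sum_div, ← Finset.sum_add_distrib, ← Finset.sum_sub_distrib]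
    refine Finset.sum_congr rfl fun k hk ↦ ?_
    have hk' := Finset.mem_range.1 hk
    have h2 := hpos _ (hτm hk')
    have h3 := hpos _ (hτm' hk')
    simp only [hR, add_sub_cancel]
    rw [Real.log_div h3.ne' h2.ne']
    ring
  have := tendsto_nhds_unique (tendsto_const_nhds.congr' hconst) hlim
  linarith

variable {Ω : Type*} {mΩ : MeasurableSpace Ω}

/-! ### Increments of Brownian motion -/

/-- The characteristic function of the linear form factorises over the independent coordinates. -/
lemma hasLaw_linear_pi_gaussianReal {ι : Type*} [Fintype ι] (a : ι → ℝ) (v : NNReal) :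
    HasLaw (fun x : ι → ℝ ↦ ∑ j, a j * x j) (gaussianReal 0 (((∑ j, a j ^ 2) * v).toNNReal))
      (Measure.pi fun _ : ι ↦ gaussianReal 0 v) := by
  have hm : Measurable (fun x : ι → ℝ ↦ ∑ j, a j * x j) := by fun_prop
  refine ⟨hm.aemeasurable, ?_⟩
  have : IsProbabilityMeasure
      (Measure.map (fun x : ι → ℝ ↦ ∑ j, a j * x j) (Measure.pi fun _ : ι ↦ gaussianReal 0 v)) :=
    Measure.isProbabilityMeasure_map hm.aemeasurable
  refine Measure.ext_of_charFun (funext fun u ↦ ?_)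
  rw [charFun_gaussianReal, charFun_apply_real, integral_map hm.aemeasurable (by fun_prop)]
  have h1 : ∀ x : ι → ℝ, Complex.exp (u * ((∑ j, a j * x j : ℝ) : ℂ) * Complex.I)
      = ∏ j, Complex.exp (((u * a j : ℝ) : ℂ) * (x j : ℂ) * Complex.I) := by
    intro x
    rw [← Complex.exp_sum]
    congr 1
    push_cast
    rw [Finset.mul_sum, Finset.sum_mul]
    exact Finset.sum_congr rfl fun j _ ↦ by ring
  simp_rw [h1]
  rw [integral_fintype_prod_eq_prod (𝕜 := ℂ) (fun j (y : ℝ) ↦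
    Complex.exp (((u * a j : ℝ) : ℂ) * (y : ℂ) * Complex.I))]
  simp_rw [← charFun_apply_real, charFun_gaussianReal]
  rw [← Complex.exp_sum]
  congr 1
  have h2 : (((∑ j, a j ^ 2) * (v : ℝ)).toNNReal : ℝ) = (∑ j, a j ^ 2) * v :=
    Real.coe_toNNReal _ (by positivity)
  rw [h2]
  push_cast
  rw [Finset.sum_mul, Finset.sum_mul, Finset.sum_div, mul_zero, zero_mul, zero_sub,
    ← Finset.sum_neg_distrib]
  exact Finset.sum_congr rfl fun j _ ↦ by ring

namespace IsBrownianMotion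

variable {ι : Type*} [Fintype ι] {P : Measure Ω} {𝓕 : Filtration ℝ mΩ} {T : ℝ}
  {W : ℝ → Ω → ι → ℝ}

lemma hasLaw_linear (hW : IsBrownianMotion P 𝓕 T W) (a : ι → ℝ) {s t : ℝ} (hs : 0 ≤ s)
    (hst : s ≤ t) (ht : t ≤ T) :
    HasLaw (fun ω ↦ ∑ j, a j * (W t ω j - W s ω j))
      (gaussianReal 0 (((∑ j, a j ^ 2) * (t - s)).toNNReal)) P := by
  have h1 := hasLaw_linear_pi_gaussianReal a (t - s).toNNReal
  rw [Real.coe_toNNReal _ (sub_nonneg.2 hst)] at h1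
  exact h1.comp (hW.law_increment s t hs hst ht)

lemma measurable_linear (hW : IsBrownianMotion P 𝓕 T W) (a : ι → ℝ) {s t : ℝ} (hs : 0 ≤ s)
    (hst : s ≤ t) (ht : t ≤ T) :
    Measurable[𝓕 t] (fun ω ↦ ∑ j, a j * (W t ω j - W s ω j)) := by
  have h1 : Measurable[𝓕 t] (W t) := hW.adapted t ⟨hs.trans hst, ht⟩
  have h2 : Measurable[𝓕 t] (W s) := (hW.adapted s ⟨hs, hst.trans ht⟩).mono (𝓕.mono hst) le_rfl
  exact (by fun_prop : Measurable fun x : (ι → ℝ) × (ι → ℝ) ↦ ∑ j, a j * (x.1 j - x.2 j)).comp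
    (h1.prodMk h2)

lemma indep_linear (hW : IsBrownianMotion P 𝓕 T W) (a : ι → ℝ) {s t : ℝ} (hs : 0 ≤ s)
    (hst : s ≤ t) (ht : t ≤ T) :
    Indep (MeasurableSpace.comap (fun ω ↦ ∑ j, a j * (W t ω j - W s ω j)) inferInstance)
      (𝓕 s) P := by
  refine indep_of_indep_of_le_left (hW.indep_increment s t hs hst ht) ?_
  have : (fun ω ↦ ∑ j, a j * (W t ω j - W s ω j))
      = (fun x : ι → ℝ ↦ ∑ j, a j * x j) ∘ (fun ω ↦ W t ω - W s ω) := rfl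
  rw [this, ← MeasurableSpace.comap_comp]
  exact MeasurableSpace.comap_mono (Measurable.comap_le (by fun_prop))

end IsBrownianMotion

/-! ### Moments of centred Gaussian variables -/

section Gaussian

variable {P : Measure Ω} {y : Ω → ℝ} {v : NNReal}

lemma memLp_of_hasLaw_gaussianReal (h : HasLaw y (gaussianReal 0 v) P) (q : NNReal) :
    MemLp y q P := by
  have := (memLp_id_gaussianReal (μ := 0) (v := v) q)
  rw [← h.map_eq] at this
  exact (memLp_map_measure_iff this.1 h.aemeasurable).1 this

lemma integral_of_hasLaw_gaussianReal (h : HasLaw y (gaussianReal 0 v) P) : ∫ ω, y ω ∂P = 0 := by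
  rw [h.integral_eq]
  simp

lemma integral_sq_of_hasLaw_gaussianReal (h : HasLaw y (gaussianReal 0 v) P) :
    ∫ ω, y ω ^ 2 ∂P = v := by
  have h1 : ∫ ω, (fun x : ℝ ↦ x ^ 2) (y ω) ∂P = ∫ x, x ^ 2 ∂gaussianReal 0 v :=
    h.integral_comp (f := fun x : ℝ ↦ x ^ 2) (by fun_prop)
  rw [h1, ← variance_fun_id_gaussianReal (μ := 0) (v := v),
    variance_of_integral_eq_zero (by fun_prop) (by simp)]

end Gaussian

/-! ### Martingale transforms -/

section Transform

variable {P : Measure Ω} {𝓖 : Filtration ℕ mΩ} {c y : ℕ → Ω → ℝ}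

/-- Orthogonality of the increments of a martingale transform. -/
lemma integral_sq_sum_transform
    (hc : ∀ p, Measurable[𝓖 p] (c p)) (hcb : ∀ p, ∃ C, ∀ ω, |c p ω| ≤ C)
    (hy : ∀ p, Measurable[𝓖 (p + 1)] (y p))
    (hyi : ∀ p, Indep (MeasurableSpace.comap (y p) inferInstance) (𝓖 p) P)
    (hy2 : ∀ p, MemLp (y p) 2 P) (hy0 : ∀ p, ∫ ω, y p ω ∂P = 0) (Q : Finset ℕ) :
    MemLp (fun ω ↦ ∑ p ∈ Q, c p ω * y p ω) 2 P ∧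
    ∫ ω, (∑ p ∈ Q, c p ω * y p ω) ^ 2 ∂P
      = ∑ p ∈ Q, (∫ ω, c p ω ^ 2 ∂P) * ∫ ω, y p ω ^ 2 ∂P := by
  have hcm : ∀ p, Measurable (c p) := fun p ↦ (hc p).mono (𝓖.le p) le_rfl
  have hym : ∀ p, Measurable (y p) := fun p ↦ (hy p).mono (𝓖.le _) le_rfl
  have hx2 : ∀ p, MemLp (fun ω ↦ c p ω * y p ω) 2 P := by
    intro p
    obtain ⟨C, hC⟩ := hcb p
    have hc' : MemLp (c p) ∞ P :=
      memLp_top_of_bound (hcm p).aestronglyMeasurable C (Eventually.of_forall hC)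
    exact (hy2 p).mul' hc'
  refine ⟨memLp_finsetSum _ fun p _ ↦ hx2 p, ?_⟩
  -- For `p < q` everything except `y q` is known at time `q`, and `y q` is centred and independent
  -- of `𝓖 q`.
  have hcross : ∀ p q, p < q → ∫ ω, (c p ω * y p ω) * (c q ω * y q ω) ∂P = 0 := by
    intro p q hpq
    have hind : IndepFun (fun ω ↦ c p ω * y p ω * c q ω) (y q) P := by
      rw [IndepFun_iff_Indep]
      refine (indep_of_indep_of_le_right (hyi q) ?_).symm
      refine Measurable.comap_le ?_
      exact (((hc p).mono (𝓖.mono hpq.le) le_rfl).mul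
        ((hy p).mono (𝓖.mono hpq) le_rfl)).mul (hc q)
    have := hind.integral_mul_eq_mul_integral
      (((hcm p).mul (hym p)).mul (hcm q)).aestronglyMeasurable (hym q).aestronglyMeasurable
    simp only [Pi.mul_apply, hy0, mul_zero] at this
    rw [← this]
    exact integral_congr_ae (Eventually.of_forall fun ω ↦ by ring)
  have hdiag : ∀ p, ∫ ω, (c p ω * y p ω) * (c p ω * y p ω) ∂P
      = (∫ ω, c p ω ^ 2 ∂P) * ∫ ω, y p ω ^ 2 ∂P := by
    intro p
    have hind : IndepFun (c p) (y p) P := by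
      rw [IndepFun_iff_Indep]
      exact (indep_of_indep_of_le_right (hyi p) (hc p).comap_le).symm
    have h2 := (hind.comp (measurable_id.pow_const 2)
      (measurable_id.pow_const 2)).integral_mul_eq_mul_integral
      ((hcm p).pow_const 2).aestronglyMeasurable ((hym p).pow_const 2).aestronglyMeasurable
    simp only [Function.comp_def, Pi.mul_def, id] at h2
    rw [← h2]
    exact integral_congr_ae (Eventually.of_forall fun ω ↦ by simp only; ring)
  simp_rw [sq (∑ p ∈ Q, _), Finset.sum_mul_sum]
  have hint : ∀ p q, Integrable (fun ω ↦ (c p ω * y p ω) * (c q ω * y q ω)) P :=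
    fun p q ↦ (hx2 p).integrable_mul (hx2 q)
  rw [integral_finsetSum _ fun p _ ↦ integrable_finsetSum _ fun q _ ↦ hint p q]
  refine Finset.sum_congr rfl fun p hp ↦ ?_
  rw [integral_finsetSum _ fun q _ ↦ hint p q, Finset.sum_eq_single_of_mem p hp, hdiag]
  intro q _ hqp
  rcases lt_or_gt_of_ne hqp with h | h
  · simp_rw [mul_comm (c p _ * y p _)]
    exact hcross q p h
  · exact hcross p q h

/-- Truncation of a martingale transform at a level of its quadratic variation. -/
lemma exists_truncated_transform {K : ℕ} {Δ : ℕ → ℝ} (hΔ : ∀ p < K, 0 < Δ p)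
    (hc : ∀ p, Measurable[𝓖 p] (c p)) {δ : ℝ} (hδ : 0 < δ) :
    ∃ c' : ℕ → Ω → ℝ, (∀ p, Measurable[𝓖 p] (c' p)) ∧ (∀ p, ∃ C, ∀ ω, |c' p ω| ≤ C) ∧
      (∀ ω, ∑ p ∈ Finset.range K, c' p ω ^ 2 * Δ p ≤ δ) ∧
      ∀ ω, ∑ p ∈ Finset.range K, c p ω ^ 2 * Δ p ≤ δ → ∀ p < K, c' p ω = c p ω := by
  classical
  -- The accumulated quadratic variation. `A (p + 1)` already includes the term `p`, yet is `𝓖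
  -- p`-measurable since `c p` is; truncating according to it keeps the transform predictable.
  set A : ℕ → Ω → ℝ := fun p ω ↦ ∑ q ∈ Finset.range p, c q ω ^ 2 * Δ q with hA
  have hAsucc : ∀ p ω, A (p + 1) ω = A p ω + c p ω ^ 2 * Δ p :=
    fun p ω ↦ Finset.sum_range_succ _ _
  have hAm : ∀ p, Measurable[𝓖 p] (A (p + 1)) := fun p ↦
    Finset.measurable_fun_sum _ fun q hq ↦ (((hc q).mono
      (𝓖.mono (Nat.lt_succ_iff.1 (Finset.mem_range.1 hq))) le_rfl).pow_const 2).mul_const _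
  have hAmono : ∀ ω p q, p ≤ q → q ≤ K → A p ω ≤ A q ω := by
    intro ω p q hpq hq
    refine Finset.sum_le_sum_of_subset_of_nonneg (Finset.range_mono hpq) fun r hr _ ↦ ?_
    exact mul_nonneg (sq_nonneg _) (hΔ r (by have := Finset.mem_range.1 hr; omega)).le
  have hA0 : ∀ ω p, p ≤ K → 0 ≤ A p ω := fun ω p hp ↦ by
    simpa [hA] using hAmono ω 0 p (Nat.zero_le p) hp
  set c' : ℕ → Ω → ℝ := fun p ω ↦ if p < K then (if A (p + 1) ω ≤ δ then c p ω else 0) else 0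
    with hc'
  refine ⟨c', fun p ↦ ?_, fun p ↦ ?_, fun ω ↦ ?_, fun ω hω p hp ↦ ?_⟩
  · by_cases hp : p < K
    · simp only [hc', hp, if_true]
      exact Measurable.ite (measurableSet_le (hAm p) measurable_const) (hc p) measurable_const
    · simp only [hc', hp, if_false]
      exact measurable_const
  -- A surviving coefficient satisfies $c_p^2\Delta_p\le A_{p+1}\le\delta$. Thus truncation also
  -- supplies boundedness, which `c` itself need not have.
  · refine ⟨√(δ / Δ p), fun ω ↦ ?_⟩
    by_cases hp : p < K
    · simp only [hc', hp, if_true]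
      split_ifs with h
      · refine Real.abs_le_sqrt ?_
        rw [le_div_iff₀ (hΔ p hp)]
        have := hAsucc p ω
        have := hA0 ω p hp.le
        linarith
      · simp
    · simp [hc', hp]
  -- The bound by `A p ω` is carried along because a step that is kept needs it; a step that is
  -- dropped uses the bound by `δ`.
  · have key : ∀ p ≤ K, ∑ q ∈ Finset.range p, c' q ω ^ 2 * Δ q ≤ min δ (A p ω) := by
      intro p
      induction p with
      | zero => intro _; simp [hA, hδ.le]
      | succ p ih =>
        intro hp
        have hp' : p < K := by omega
        have h1 := ih hp'.le
        rw [Finset.sum_range_succ]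
        simp only [hc', hp', if_true]
        split_ifs with h
        · rw [min_eq_right h, hAsucc]
          have := h1.trans (min_le_right _ _)
          gcongr
        · rw [min_eq_left (not_le.1 h).le]
          refine le_trans (le_of_eq ?_) (h1.trans (min_le_left _ _))
          rw [zero_pow two_ne_zero, zero_mul, add_zero]
    exact (key K le_rfl).trans (min_le_left _ _)
  · simp only [hc', hp, if_true]
    rw [if_pos ((hAmono ω (p + 1) K hp le_rfl).trans hω)]

/-- A Lenglart-type inequality for the block sums of a martingale transform and their squares. -/
lemma measure_transform_le [IsProbabilityMeasure P] {K n : ℕ} {Δ : ℕ → ℝ} (hΔ : ∀ p < K, 0 < Δ p)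
    (hc : ∀ p, Measurable[𝓖 p] (c p)) (hy : ∀ p, Measurable[𝓖 (p + 1)] (y p))
    (hyi : ∀ p, Indep (MeasurableSpace.comap (y p) inferInstance) (𝓖 p) P)
    (hy2 : ∀ p, MemLp (y p) 2 P) (hy0 : ∀ p, ∫ ω, y p ω ∂P = 0)
    (hyΔ : ∀ p < K, ∫ ω, y p ω ^ 2 ∂P = Δ p)
    {Q : ℕ → Finset ℕ} (hQ : ∀ k ∈ Finset.range n, Q k ⊆ Finset.range K)
    (hQd : (↑(Finset.range n) : Set ℕ).PairwiseDisjoint Q) {δ ε : ℝ} (hδ : 0 < δ) (hε : 0 < ε) :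
    P {ω | ε ≤ (∑ k ∈ Finset.range n, ∑ p ∈ Q k, c p ω * y p ω) ^ 2
        + ∑ k ∈ Finset.range n, (∑ p ∈ Q k, c p ω * y p ω) ^ 2}
      ≤ P {ω | δ < ∑ p ∈ Finset.range K, c p ω ^ 2 * Δ p} + ENNReal.ofReal (2 * δ / ε) := by
  obtain ⟨c', hc', hcb', hle, heq⟩ := exists_truncated_transform hΔ hc hδ
  have hcm' : ∀ p, Measurable (c' p) := fun p ↦ (hc' p).mono (𝓖.le p) le_rfl
  have key := integral_sq_sum_transform hc' hcb' hy hyi hy2 hy0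
  set Y : Ω → ℝ := fun ω ↦ (∑ k ∈ Finset.range n, ∑ p ∈ Q k, c' p ω * y p ω) ^ 2
        + ∑ k ∈ Finset.range n, (∑ p ∈ Q k, c' p ω * y p ω) ^ 2 with hY
  have hY0 : ∀ ω, 0 ≤ Y ω := fun ω ↦ by positivity
  have hc2i : ∀ p, Integrable (fun ω ↦ c' p ω ^ 2) P := by
    intro p
    obtain ⟨C, hC⟩ := hcb' p
    refine Integrable.of_bound ((hcm' p).pow_const 2).aestronglyMeasurable (C ^ 2)
      (Eventually.of_forall fun ω ↦ ?_)
    rw [norm_pow]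
    exact pow_le_pow_left₀ (norm_nonneg _) (hC ω) 2
  have hsub : (Finset.range n).biUnion Q ⊆ Finset.range K :=
    Finset.biUnion_subset.2 hQ
  have hbound : ∑ p ∈ (Finset.range n).biUnion Q, (∫ ω, c' p ω ^ 2 ∂P) * ∫ ω, y p ω ^ 2 ∂P
      ≤ δ := by
    calc _ ≤ ∑ p ∈ Finset.range K, (∫ ω, c' p ω ^ 2 ∂P) * ∫ ω, y p ω ^ 2 ∂P :=
          Finset.sum_le_sum_of_subset_of_nonneg hsub fun p _ _ ↦
            mul_nonneg (integral_nonneg fun ω ↦ sq_nonneg _) (integral_nonneg fun ω ↦ sq_nonneg _)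
      _ = ∑ p ∈ Finset.range K, ∫ ω, c' p ω ^ 2 * Δ p ∂P := by
          refine Finset.sum_congr rfl fun p hp ↦ ?_
          rw [integral_mul_const, hyΔ p (Finset.mem_range.1 hp)]
      _ = ∫ ω, ∑ p ∈ Finset.range K, c' p ω ^ 2 * Δ p ∂P :=
          (integral_finsetSum _ fun p _ ↦ (hc2i p).mul_const _).symm
      _ ≤ ∫ _, δ ∂P := integral_mono
          (integrable_finsetSum _ fun p _ ↦ (hc2i p).mul_const _) (integrable_const _) hle
      _ = δ := by simp
  -- By orthogonality, the square of the total and the sum of the squared blocks have the same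
  -- expectation, at most `δ`.
  have hYi : Integrable Y P ∧ ∫ ω, Y ω ∂P ≤ 2 * δ := by
    have h1 : ∀ ω, ∑ k ∈ Finset.range n, ∑ p ∈ Q k, c' p ω * y p ω
        = ∑ p ∈ (Finset.range n).biUnion Q, c' p ω * y p ω :=
      fun ω ↦ (Finset.sum_biUnion hQd).symm
    have h2 : Integrable (fun ω ↦ (∑ k ∈ Finset.range n, ∑ p ∈ Q k, c' p ω * y p ω) ^ 2) P := by
      simp_rw [h1]; exact (key _).1.integrable_sq
    have h3 : Integrable (fun ω ↦ ∑ k ∈ Finset.range n, (∑ p ∈ Q k, c' p ω * y p ω) ^ 2) P :=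
      integrable_finsetSum _ fun k _ ↦ (key _).1.integrable_sq
    refine ⟨h2.add h3, ?_⟩
    rw [hY, integral_add h2 h3, two_mul]
    refine add_le_add ?_ ?_
    · simp_rw [h1]; rw [(key _).2]; exact hbound
    · rw [integral_finsetSum _ fun k _ ↦ (key _).1.integrable_sq]
      simp_rw [(key _).2]
      rw [← Finset.sum_biUnion hQd]
      exact hbound
  have hmarkov : P {ω | ε ≤ Y ω} ≤ ENNReal.ofReal (2 * δ / ε) := by
    have h1 := mul_meas_ge_le_integral_of_nonneg (Eventually.of_forall hY0) hYi.1 ε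
    rw [← ofReal_measureReal (by finiteness)]
    refine ENNReal.ofReal_le_ofReal ?_
    rw [le_div_iff₀ hε]
    linarith [hYi.2]
  -- Where the quadratic variation stays at most `δ`, truncation changes nothing, and Markov's
  -- inequality for `Y` applies.
  calc _ ≤ P ({ω | δ < ∑ p ∈ Finset.range K, c p ω ^ 2 * Δ p} ∪ {ω | ε ≤ Y ω}) := by
        refine measure_mono fun ω hω ↦ ?_
        by_cases h : δ < ∑ p ∈ Finset.range K, c p ω ^ 2 * Δ p
        · exact Or.inl h
        · right
          have h1 : ∀ k ∈ Finset.range n, ∑ p ∈ Q k, c' p ω * y p ω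
              = ∑ p ∈ Q k, c p ω * y p ω := fun k hk ↦ Finset.sum_congr rfl fun p hp ↦ by
            rw [heq ω (not_lt.1 h) p (Finset.mem_range.1 (hQ k hk hp))]
          have h2 : Y ω = (∑ k ∈ Finset.range n, ∑ p ∈ Q k, c p ω * y p ω) ^ 2
              + ∑ k ∈ Finset.range n, (∑ p ∈ Q k, c p ω * y p ω) ^ 2 := by
            rw [hY]
            exact congrArg₂ _ (congrArg (· ^ 2) (Finset.sum_congr rfl h1))
              (Finset.sum_congr rfl fun k hk ↦ congrArg (· ^ 2) (h1 k hk))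
          exact hω.trans_eq h2.symm
    _ ≤ _ := (measure_union_le _ _).trans (by gcongr)

end Transform

/-! ### Elementary integrals on refined grids -/

/-- Enumeration of a finite set of reals in increasing order. -/
lemma exists_monotone_enumeration {D : Finset ℝ} (hD : D.Nonempty) :
    ∃ (K : ℕ) (u : ℕ → ℝ), Monotone u ∧ (∀ p < K, u p < u (p + 1)) ∧ (∀ p, u p ∈ D) ∧
      ∀ s ∈ D, ∃ p ≤ K, u p = s := by
  have hcard : D.card = (D.card - 1) + 1 := (Nat.succ_pred_eq_of_pos hD.card_pos).symm
  set K := D.card - 1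
  set e := D.orderEmbOfFin hcard
  -- The enumeration is frozen at the largest element after index `K`.
  refine ⟨K, fun p ↦ e ⟨min p K, by omega⟩, fun p q hpq ↦ ?_, fun p hp ↦ ?_, fun p ↦ ?_,
    fun s hs ↦ ?_⟩
  · exact e.monotone (Fin.mk_le_mk.2 (by omega))
  · exact e.strictMono (Fin.mk_lt_mk.2 (by omega))
  · exact D.orderEmbOfFin_mem hcard _
  · have : s ∈ Set.range e := by rw [D.range_orderEmbOfFin hcard]; exact hs
    obtain ⟨i, rfl⟩ := this
    refine ⟨i, by omega, ?_⟩
    exact congrArg e (Fin.ext (min_eq_left (by omega)))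

namespace IsBrownianMotion

variable {ι : Type*} [Fintype ι] {P : Measure Ω} {𝓕 : Filtration ℝ mΩ} {T : ℝ}
  {W : ℝ → Ω → ι → ℝ}

lemma hasLaw_coord (hW : IsBrownianMotion P 𝓕 T W) (j : ι) {s t : ℝ} (hs : 0 ≤ s)
    (hst : s ≤ t) (ht : t ≤ T) :
    HasLaw (fun ω ↦ W t ω j - W s ω j) (gaussianReal 0 (t - s).toNNReal) P := by
  classical
  simpa [Pi.single_apply] using hW.hasLaw_linear (Pi.single j 1) hs hst ht

lemma measurable_coord (hW : IsBrownianMotion P 𝓕 T W) (j : ι) {s t : ℝ} (hs : 0 ≤ s)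
    (hst : s ≤ t) (ht : t ≤ T) : Measurable[𝓕 t] (fun ω ↦ W t ω j - W s ω j) := by
  classical
  simpa [Pi.single_apply] using hW.measurable_linear (Pi.single j 1) hs hst ht

lemma indep_coord (hW : IsBrownianMotion P 𝓕 T W) (j : ι) {s t : ℝ} (hs : 0 ≤ s)
    (hst : s ≤ t) (ht : t ≤ T) :
    Indep (MeasurableSpace.comap (fun ω ↦ W t ω j - W s ω j) inferInstance) (𝓕 s) P := by
  classical
  simpa [Pi.single_apply] using hW.indep_linear (Pi.single j 1) hs hst ht

end IsBrownianMotion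

/-- The filtration observed at an increasing sequence of times. -/
def sampledFiltration (𝓕 : Filtration ℝ mΩ) {u : ℕ → ℝ} (hu : Monotone u) : Filtration ℕ mΩ where
  seq p := 𝓕 (u p)
  mono' _ _ h := 𝓕.mono (hu h)
  le' p := 𝓕.le (u p)

/-! ### Simple processes on grids containing their jump times -/

section SimpleOnGrid

variable {𝓕 : Filtration ℝ mΩ} {T : ℝ} (V : SimpleProcess 𝓕 T)
  {K : ℕ} {u : ℕ → ℝ} (hu : Monotone u) (hus : ∀ p < K, u p < u (p + 1))

include hu hus in
lemma lt_iff_of_enumeration {p q : ℕ} (hp : p ≤ K) (hq : q ≤ K) : u p < u q ↔ p < q := by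
  refine ⟨fun h ↦ ?_, fun h ↦ ?_⟩
  · by_contra hc
    exact absurd (hu (not_lt.1 hc)) (not_le.2 h)
  · exact (hus p (by omega)).trans_le (hu h)

variable (hV : ∀ l ≤ V.size, ∃ p ≤ K, u p = V.time l)

include hu hus hV in
-- No jump time lies strictly inside a cell, and the steps of `V` are open on the left and closed on
-- the right, so the right endpoint represents the cell.
lemma SimpleProcess.val_eq_of_mem {p : ℕ} (hp : p < K) {s : ℝ} (hs : s ∈ Ioc (u p) (u (p + 1)))
    (ω : Ω) : V.val s ω = V.val (u (p + 1)) ω := by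
  unfold SimpleProcess.val
  refine Finset.sum_congr rfl fun l hl ↦ ?_
  have hl' := Finset.mem_range.1 hl
  have key : ∀ l ≤ V.size, (V.time l < s ↔ V.time l < u (p + 1)) := by
    intro l hl
    obtain ⟨q, hq, hqe⟩ := hV l hl
    rw [← hqe, lt_iff_of_enumeration hu hus hq hp]
    refine ⟨fun h ↦ ?_, fun h ↦ (hu (Nat.lt_succ_iff.1 h)).trans_lt hs.1⟩
    exact (lt_iff_of_enumeration hu hus hq hp).1 (h.trans_le hs.2)
  have h1 := key l hl'.le
  have h2 := key (l + 1) hl'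
  have : (s ∈ Ioc (V.time l) (V.time (l + 1))) = (u (p + 1) ∈ Ioc (V.time l) (V.time (l + 1))) := by
    simp only [mem_Ioc, ← not_lt]
    rw [h1, h2]
  simp only [indicator_apply, this]

include hu hus hV in
-- Predictability: a step that covers `u (p + 1)` starts no later than `u p`, when its coefficient
-- is already known.
lemma SimpleProcess.measurable_val {p : ℕ} (hp : p < K) :
    Measurable[𝓕 (u p)] (V.val (u (p + 1))) := by
  unfold SimpleProcess.val
  refine Finset.measurable_fun_sum _ fun l hl ↦ ?_
  by_cases h : u (p + 1) ∈ Ioc (V.time l) (V.time (l + 1))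
  · simp only [indicator_of_mem h]
    obtain ⟨q, hq, hqe⟩ := hV l (Finset.mem_range.1 hl).le
    have h1 := h.1
    rw [← hqe, lt_iff_of_enumeration hu hus hq hp] at h1
    refine (V.coef_measurable l).mono (𝓕.mono ?_) le_rfl
    rw [← hqe]
    exact hu (Nat.lt_succ_iff.1 h1)
  · simp only [indicator_of_notMem h]
    exact measurable_const

include hu hus hV in
lemma SimpleProcess.integral_succ_sub {p : ℕ} (hp : p < K) (B : ℝ → Ω → ℝ) (ω : Ω) :
    V.integral B (u (p + 1)) ω - V.integral B (u p) ω
      = V.val (u (p + 1)) ω * (B (u (p + 1)) ω - B (u p) ω) := by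
  unfold SimpleProcess.val SimpleProcess.integral
  rw [← Finset.sum_sub_distrib, Finset.sum_mul]
  refine Finset.sum_congr rfl fun l hl ↦ ?_
  have hl' := Finset.mem_range.1 hl
  obtain ⟨q, hq, hqe⟩ := hV l hl'.le
  obtain ⟨r, hr, hre⟩ := hV (l + 1) hl'
  have hqr : q ≤ r := by
    by_contra hc
    have := (lt_iff_of_enumeration hu hus hr hq).2 (not_le.1 hc)
    rw [hqe, hre] at this
    exact absurd (V.time_mono l.le_succ) (not_le.2 this)
  have hmem : u (p + 1) ∈ Ioc (V.time l) (V.time (l + 1)) ↔ q ≤ p ∧ p < r := by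
    rw [mem_Ioc, ← not_lt, ← hqe, ← hre, lt_iff_of_enumeration hu hus hq hp,
      lt_iff_of_enumeration hu hus hr hp]
    omega
  simp only [indicator_apply, hmem]
  rw [← hqe, ← hre, ← hu.map_min, ← hu.map_min, ← hu.map_min, ← hu.map_min]
  by_cases h1 : p < q
  · rw [if_neg (by omega), min_eq_left (by omega : p + 1 ≤ r), min_eq_left (by omega : p + 1 ≤ q),
      min_eq_left (by omega : p ≤ r), min_eq_left (by omega : p ≤ q)]
    ring
  · by_cases h2 : p < r
    · rw [if_pos (by omega), min_eq_left (by omega : p + 1 ≤ r), min_eq_right (by omega : q ≤ p + 1),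
        min_eq_left (by omega : p ≤ r), min_eq_right (by omega : q ≤ p)]
      ring
    · rw [if_neg (by omega), min_eq_right (by omega : r ≤ p + 1),
        min_eq_right (by omega : q ≤ p + 1), min_eq_right (by omega : r ≤ p),
        min_eq_right (by omega : q ≤ p)]
      ring

end SimpleOnGrid

/-- The weighted increments over a uniform grid of the elementary integral of a simple process,
compensated by a multiple of the increments of the Brownian motion, are controlled by the
square integral of the weighted, compensated integrand. -/
lemma SimpleProcess.measure_block_sums_le {ι : Type*} [Fintype ι] {P : Measure Ω}
    [IsProbabilityMeasure P] {𝓕 : Filtration ℝ mΩ} {T : ℝ} {W : ℝ → Ω → ι → ℝ}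
    (hW : IsBrownianMotion P 𝓕 T W) (V : SimpleProcess 𝓕 T) (j : ι) {t : ℝ} (ht0 : 0 ≤ t)
    (htT : t ≤ T) {n : ℕ} (hn : 0 < n) {w : ℕ → Ω → ℝ}
    (hw : ∀ k < n, Measurable[𝓕 (unifGrid 0 t n k)] (w k)) (σ : ℝ) {d : ℕ → Ω → ℝ} {A : Ω → ℝ}
    (hd : ∀ k ω, d k ω = w k ω * (V.integral (fun s ω ↦ W s ω j) (unifGrid 0 t n (k + 1)) ω
        - V.integral (fun s ω ↦ W s ω j) (unifGrid 0 t n k) ω)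
      - σ * (W (unifGrid 0 t n (k + 1)) ω j - W (unifGrid 0 t n k) ω j))
    (hA : ∀ ω, A ω = ∑ k ∈ Finset.range n,
      ∫ s in unifGrid 0 t n k..unifGrid 0 t n (k + 1), (w k ω * V.val s ω - σ) ^ 2) :
    Measurable A ∧ ∀ δ > 0, ∀ ε > 0,
      P {ω | ε ≤ (∑ k ∈ Finset.range n, d k ω) ^ 2 + ∑ k ∈ Finset.range n, d k ω ^ 2}
        ≤ P {ω | δ < A ω} + ENNReal.ofReal (2 * δ / ε) := by
  classical
  set τ : ℕ → ℝ := unifGrid 0 t n with hτ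
  have hτm : Monotone τ := unifGrid_monotone ht0
  -- On the common refinement of the uniform grid and the jump times of `V`, the weighted,
  -- compensated integrand is constant on each cell.
  set D : Finset ℝ := (Finset.range (n + 1)).image τ ∪ (Finset.range (V.size + 1)).image V.time
    with hD
  have hDT : ∀ s ∈ D, s ∈ Icc 0 T := by
    intro s hs
    rw [hD, Finset.mem_union, Finset.mem_image, Finset.mem_image] at hs
    rcases hs with ⟨k, hk, rfl⟩ | ⟨l, _, rfl⟩
    · exact Icc_subset_Icc_right htT
        (unifGrid_mem ht0 hn (Nat.lt_succ_iff.1 (Finset.mem_range.1 hk)))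
    · exact V.time_mem l
  obtain ⟨K, u, hu, hus, huD, hDu⟩ := exists_monotone_enumeration
    (D := D) ⟨τ 0, Finset.mem_union_left _ (Finset.mem_image_of_mem _ (by simp))⟩
  have huT : ∀ p, u p ∈ Icc 0 T := fun p ↦ hDT _ (huD p)
  have hV : ∀ l ≤ V.size, ∃ p ≤ K, u p = V.time l := fun l hl ↦
    hDu _ (Finset.mem_union_right _ (Finset.mem_image_of_mem _ (Finset.mem_range.2 (by omega))))
  have hi : ∀ k, ∃ p ≤ K, k ≤ n → u p = τ k := by
    intro k
    by_cases hk : k ≤ n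
    · obtain ⟨p, hp, he⟩ := hDu (τ k) (Finset.mem_union_left _
        (Finset.mem_image_of_mem _ (Finset.mem_range.2 (by omega))))
      exact ⟨p, hp, fun _ ↦ he⟩
    · exact ⟨0, Nat.zero_le _, fun h ↦ absurd h hk⟩
  choose i hiK hiτ using hi
  have himono : ∀ k l, k ≤ l → l ≤ n → i k ≤ i l := by
    intro k l hkl hl
    by_contra hc
    have := (lt_iff_of_enumeration hu hus (hiK l) (hiK k)).2 (not_le.1 hc)
    rw [hiτ l hl, hiτ k (hkl.trans hl)] at this
    exact absurd (hτm hkl) (not_le.2 this)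
  -- The refined cells that make up the `k`-th uniform cell.
  set Q : ℕ → Finset ℕ := fun k ↦ Finset.Ico (i k) (i (k + 1)) with hQ
  have hQK : ∀ k ∈ Finset.range n, Q k ⊆ Finset.range K := by
    intro k _ p hp
    have := (Finset.mem_Ico.1 hp).2
    have := hiK (k + 1)
    exact Finset.mem_range.2 (by omega)
  have hQlt : ∀ k l, k < l → l < n → ∀ p ∈ Q k, p ∉ Q l := by
    intro k l hkl hl p hp hp'
    have h1 := (Finset.mem_Ico.1 hp).2
    have h2 := (Finset.mem_Ico.1 hp').1
    have := himono (k + 1) l hkl (by omega)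
    omega
  have hQu : ∀ k < n, ∀ l < n, ∀ p, p ∈ Q k → p ∈ Q l → k = l := by
    intro k hk l hl p hp hp'
    rcases lt_trichotomy k l with h | h | h
    · exact absurd hp' (hQlt k l h hl p hp)
    · exact h
    · exact absurd hp (hQlt l k h hk p hp')
  have hQd : (↑(Finset.range n) : Set ℕ).PairwiseDisjoint Q := by
    intro k hk l hl hkl
    refine Finset.disjoint_left.2 fun p hp hp' ↦ hkl ?_
    exact hQu k (Finset.mem_range.1 hk) l (Finset.mem_range.1 hl) p hp hp'
  -- At most one summand is nonzero. Refined cells beyond `t`, caused by later jump times of `V`,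
  -- lie in no block and get coefficient zero.
  set c : ℕ → Ω → ℝ := fun p ω ↦ ∑ k ∈ Finset.range n,
    if p ∈ Q k then w k ω * V.val (u (p + 1)) ω - σ else 0 with hc
  have hcQ : ∀ k < n, ∀ p ∈ Q k, ∀ ω, c p ω = w k ω * V.val (u (p + 1)) ω - σ := by
    intro k hk p hp ω
    rw [hc]
    simp only
    rw [Finset.sum_eq_single_of_mem k (Finset.mem_range.2 hk), if_pos hp]
    intro l hl hlk
    rw [if_neg]
    exact fun h ↦ hlk (hQu l (Finset.mem_range.1 hl) k hk p h hp)
  have hc0 : ∀ p, p ∉ (Finset.range n).biUnion Q → ∀ ω, c p ω = 0 := by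
    intro p hp ω
    refine Finset.sum_eq_zero fun k hk ↦ if_neg fun h ↦ hp ?_
    exact Finset.mem_biUnion.2 ⟨k, hk, h⟩
  set 𝓖 := sampledFiltration 𝓕 hu
  have hcm : ∀ p, Measurable[𝓖 p] (c p) := by
    intro p
    refine Finset.measurable_fun_sum _ fun k hk ↦ ?_
    have hk' := Finset.mem_range.1 hk
    by_cases hp : p ∈ Q k
    · simp only [hp, if_true]
      have hpK := Finset.mem_range.1 (hQK k hk hp)
      have h1 : Measurable[𝓖 p] (w k) := by
        refine (hw k hk').mono (𝓕.mono ?_) le_rfl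
        rw [← hiτ k hk'.le]
        exact hu (Finset.mem_Ico.1 hp).1
      have h2 : Measurable[𝓖 p] (V.val (u (p + 1))) := V.measurable_val hu hus hV hpK
      exact (h1.mul h2).sub_const σ
    · simp only [hp, if_false]
      exact measurable_const
  set y : ℕ → Ω → ℝ := fun p ω ↦ W (u (p + 1)) ω j - W (u p) ω j with hy
  have hlaw : ∀ p, HasLaw (y p) (gaussianReal 0 (u (p + 1) - u p).toNNReal) P := fun p ↦
    hW.hasLaw_coord j (huT p).1 (hu p.le_succ) (huT (p + 1)).2
  -- `A` is exactly the quadratic variation of the transform, the quantity bounded in the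
  -- Lenglart-type inequality.
  have hAeq : ∀ ω, A ω = ∑ p ∈ Finset.range K, c p ω ^ 2 * (u (p + 1) - u p) := by
    intro ω
    rw [hA, ← Finset.sum_subset (Finset.biUnion_subset.2 hQK) (fun p _ hp ↦ by
      rw [hc0 p hp]; ring), Finset.sum_biUnion hQd]
    refine Finset.sum_congr rfl fun k hk ↦ ?_
    have hk' := Finset.mem_range.1 hk
    rw [← hiτ k hk'.le, ← hiτ (k + 1) hk']
    have hpt : ∀ p ∈ Q k, ∀ s ∈ uIoc (u p) (u (p + 1)),
        (w k ω * V.val s ω - σ) ^ 2 = c p ω ^ 2 := by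
      intro p hp s hs
      rw [uIoc_of_le (hu p.le_succ)] at hs
      rw [hcQ k hk' p hp, V.val_eq_of_mem hu hus hV (Finset.mem_range.1 (hQK k hk hp)) hs]
    rw [← intervalIntegral.sum_integral_adjacent_intervals_Ico (himono k (k + 1) k.le_succ hk')]
    · refine Finset.sum_congr rfl fun p hp ↦ ?_
      rw [intervalIntegral.integral_congr_ae (Eventually.of_forall (hpt p hp)),
        intervalIntegral.integral_const, smul_eq_mul, mul_comm]
    · intro p hp
      refine (intervalIntegrable_const (c := c p ω ^ 2)).congr ?_
      exact fun s hs ↦ (hpt p (Finset.mem_Ico.2 hp) s hs).symm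
  have hdeq : ∀ k ∈ Finset.range n, ∀ ω, d k ω = ∑ p ∈ Q k, c p ω * y p ω := by
    intro k hk ω
    have hk' := Finset.mem_range.1 hk
    have htel : ∀ f : ℕ → ℝ, ∑ p ∈ Q k, (f (p + 1) - f p) = f (i (k + 1)) - f (i k) := by
      intro f
      rw [hQ, Finset.sum_Ico_eq_sub _ (himono k (k + 1) k.le_succ hk'), Finset.sum_range_sub,
        Finset.sum_range_sub]
      ring
    have h1 := htel fun p ↦ V.integral (fun s ω ↦ W s ω j) (u p) ω
    have h2 := htel fun p ↦ W (u p) ω j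
    simp only [hiτ k hk'.le, hiτ (k + 1) hk'] at h1 h2
    rw [hd, ← h1, ← h2, Finset.mul_sum, Finset.mul_sum, ← Finset.sum_sub_distrib]
    refine Finset.sum_congr rfl fun p hp ↦ ?_
    rw [V.integral_succ_sub hu hus hV (Finset.mem_range.1 (hQK k hk hp)), hcQ k hk' p hp, hy]
    ring
  refine ⟨?_, fun δ hδ ε hε ↦ ?_⟩
  · rw [funext hAeq]
    exact Finset.measurable_fun_sum _ fun p _ ↦
      (((hcm p).mono (𝓖.le p) le_rfl).pow_const 2).mul_const _
  · have h1 := measure_transform_le (P := P) (𝓖 := 𝓖) (c := c) (y := y) (K := K) (n := n)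
      (Δ := fun p ↦ u (p + 1) - u p) (fun p hp ↦ sub_pos.2 (hus p hp)) hcm
      (fun p ↦ hW.measurable_coord j (huT p).1 (hu p.le_succ) (huT (p + 1)).2)
      (fun p ↦ hW.indep_coord j (huT p).1 (hu p.le_succ) (huT (p + 1)).2)
      (fun p ↦ memLp_of_hasLaw_gaussianReal (hlaw p) 2)
      (fun p ↦ integral_of_hasLaw_gaussianReal (hlaw p))
      (fun p hp ↦ by
        rw [integral_sq_of_hasLaw_gaussianReal (hlaw p),
          Real.coe_toNNReal _ (sub_nonneg.2 (hu p.le_succ))]) hQK hQd hδ hε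
    simp_rw [← hAeq] at h1
    refine le_trans (measure_mono fun ω hω ↦ ?_) h1
    have h2 : ∑ k ∈ Finset.range n, d k ω = ∑ k ∈ Finset.range n, ∑ p ∈ Q k, c p ω * y p ω :=
      Finset.sum_congr rfl fun k hk ↦ hdeq k hk ω
    have h3 : ∑ k ∈ Finset.range n, d k ω ^ 2
        = ∑ k ∈ Finset.range n, (∑ p ∈ Q k, c p ω * y p ω) ^ 2 :=
      Finset.sum_congr rfl fun k hk ↦ by rw [hdeq k hk ω]
    exact (show ε ≤ _ from hω).trans_eq (by rw [h2, h3])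

/-! ### Itô's formula for the logarithm of a process with constant relative volatility -/

lemma tendstoInMeasure_zero_iff {P : Measure Ω} {f : ℕ → Ω → ℝ} :
    TendstoInMeasure P f atTop (fun _ ↦ 0) ↔
      ∀ ε > 0, Tendsto (fun n ↦ P {ω | ε ≤ |f n ω|}) atTop (𝓝 0) := by
  rw [tendstoInMeasure_iff_norm]
  simp only [sub_zero, Real.norm_eq_abs]

/-- Subsequences are extracted successively, one index after the other; later extractions preserve
the earlier limits. -/
lemma exists_seq_tendsto_ae_finite {P : Measure Ω} {κ : Type*} [Fintype κ] {f : κ → ℕ → Ω → ℝ}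
    (hf : ∀ i, TendstoInMeasure P (f i) atTop (fun _ ↦ 0)) :
    ∃ ν : ℕ → ℕ, StrictMono ν ∧
      ∀ i, ∀ᵐ ω ∂P, Tendsto (fun k ↦ f i (ν k) ω) atTop (𝓝 0) := by
  classical
  have : ∀ s : Finset κ, ∃ ν : ℕ → ℕ, StrictMono ν ∧
      ∀ i ∈ s, ∀ᵐ ω ∂P, Tendsto (fun k ↦ f i (ν k) ω) atTop (𝓝 0) := by
    intro s
    induction s using Finset.induction_on with
    | empty => exact ⟨id, strictMono_id, by simp⟩
    | insert i s _ ih =>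
      obtain ⟨ν, hν, h⟩ := ih
      obtain ⟨ν', hν', h'⟩ := ((hf i).comp hν.tendsto_atTop).exists_seq_tendsto_ae
      refine ⟨ν ∘ ν', hν.comp hν', fun l hl ↦ ?_⟩
      rcases Finset.mem_insert.1 hl with rfl | hl
      · exact h'
      · filter_upwards [h l hl] with ω hω
        exact hω.comp hν'.tendsto_atTop
  obtain ⟨ν, hν, h⟩ := this Finset.univ
  exact ⟨ν, hν, fun i ↦ h i (Finset.mem_univ i)⟩

/-- Simple processes approximating an Itô integral almost surely, at a prescribed rate. -/
lemma IsItoIntegral.exists_approx_ae {P : Measure Ω} {𝓕 : Filtration ℝ mΩ} {T : ℝ}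
    {B H I : ℝ → Ω → ℝ} (h : IsItoIntegral P 𝓕 T B H I) :
    ∃ V : ℕ → SimpleProcess 𝓕 T, ∀ᵐ ω ∂P,
      Tendsto (fun n ↦ ∫⁻ s in Icc 0 T, ‖(V n).val s ω - H s ω‖ₑ ^ 2) atTop (𝓝 0) ∧
      ∀ᶠ n : ℕ in atTop, ∀ t ∈ Icc 0 T,
        |(V n).integral B t ω - I t ω| < 1 / ((n : ℝ) + 1) ^ 2 := by
  obtain ⟨V, hV1, hV2⟩ := h.exists_approx
  have hpow : ∀ n : ℕ, (0 : ℝ≥0∞) < (2⁻¹ : ℝ≥0∞) ^ n := fun n ↦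
    ENNReal.pow_pos (by simp) n
  have hr : ∀ n : ℕ, (0 : ℝ) < 1 / ((n : ℝ) + 1) ^ 2 := fun n ↦ by positivity
  -- Exceptional probabilities at most $2^{-n}$ are summable, so Borel–Cantelli applies. The rate
  -- $1/(n+1)^2$ lets the errors at all points of an $n$-cell grid add up to $O(1/n)$.
  have hex : ∀ n : ℕ, ∃ m,
      P {ω | ((n : ℝ≥0∞) + 1)⁻¹ ≤ ∫⁻ s in Icc 0 T, ‖(V m).val s ω - H s ω‖ₑ ^ 2} ≤ 2⁻¹ ^ n ∧
      P {ω | ∃ t ∈ Icc 0 T, 1 / ((n : ℝ) + 1) ^ 2 ≤ |(V m).integral B t ω - I t ω|}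
        ≤ 2⁻¹ ^ n := by
    intro n
    have h1 := hV1 ((n : ℝ≥0∞) + 1)⁻¹ (ENNReal.inv_pos.2 (by finiteness))
    have h2 := hV2 _ (hr n)
    have e1 := ENNReal.tendsto_nhds_zero.1 h1 _ (hpow n)
    have e2 := ENNReal.tendsto_nhds_zero.1 h2 _ (hpow n)
    exact (e1.and e2).exists
  choose m hm1 hm2 using hex
  have hsum : ∑' n : ℕ, (2⁻¹ : ℝ≥0∞) ^ n ≠ ∞ := by
    rw [ENNReal.tsum_geometric, ENNReal.one_sub_inv_two, inv_inv]
    exact ENNReal.ofNat_ne_top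
  have bc1 := ae_eventually_notMem (ne_top_of_le_ne_top hsum (ENNReal.tsum_le_tsum hm1))
  have bc2 := ae_eventually_notMem (ne_top_of_le_ne_top hsum (ENNReal.tsum_le_tsum hm2))
  refine ⟨fun n ↦ V (m n), ?_⟩
  filter_upwards [bc1, bc2] with ω h1 h2
  constructor
  · have h3 : Tendsto (fun n : ℕ ↦ ((n : ℝ≥0∞) + 1)⁻¹) atTop (𝓝 0) := by
      have := (tendsto_add_atTop_iff_nat 1).2 ENNReal.tendsto_inv_nat_nhds_zero
      simpa using this
    refine tendsto_of_tendsto_of_tendsto_of_le_of_le' tendsto_const_nhds h3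
      (Eventually.of_forall fun _ ↦ zero_le) ?_
    filter_upwards [h1] with n hn
    exact (not_le.1 hn).le
  · filter_upwards [h2] with n hn t ht
    by_contra hc
    exact hn ⟨t, ht, not_lt.1 hc⟩

/-! ### Quadratic variation along uniform grids -/

section Variation

variable {ι : Type*} [Fintype ι] {P : Measure Ω} [IsProbabilityMeasure P] {𝓕 : Filtration ℝ mΩ}
  {T : ℝ} {W : ℝ → Ω → ι → ℝ}

/-- `y` is in law $\sqrt v$ times a standard Gaussian. Only the factor $v^2$ matters later, so the
constant is left as an integral. -/
lemma integral_sq_sq_sub_of_hasLaw_gaussianReal {y : Ω → ℝ} {v : ℝ} (hv : 0 ≤ v)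
    (h : HasLaw y (gaussianReal 0 v.toNNReal) P) :
    MemLp (fun ω ↦ y ω ^ 2 - v) 2 P ∧ ∫ ω, (y ω ^ 2 - v) ^ 2 ∂P
      = v ^ 2 * ∫ x, (x ^ 2 - 1) ^ 2 ∂gaussianReal 0 1 := by
  have hmap : (gaussianReal 0 1).map (√v * ·) = gaussianReal 0 v.toNNReal := by
    rw [gaussianReal_map_const_mul]
    congr 1
    · simp
    · ext
      simp [Real.sq_sqrt hv, hv]
  constructor
  · have h4 : MemLp y 4 P := memLp_of_hasLaw_gaussianReal h 4
    have h2 : MemLp (fun ω ↦ y ω ^ 2) 2 P := by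
      have := h4.mul' (r := 2) h4 (hpqr := ⟨by
        rw [← ENNReal.toReal_eq_toReal_iff' (by finiteness) (by finiteness)]
        rw [ENNReal.toReal_add (by finiteness) (by finiteness)]
        norm_num⟩)
      simpa [sq] using this
    exact h2.sub (memLp_const v)
  · have h1 : ∫ ω, (fun x : ℝ ↦ (x ^ 2 - v) ^ 2) (y ω) ∂P
        = ∫ x, (x ^ 2 - v) ^ 2 ∂gaussianReal 0 v.toNNReal :=
      h.integral_comp (f := fun x : ℝ ↦ (x ^ 2 - v) ^ 2) (by fun_prop)
    rw [h1, ← hmap, integral_map (by fun_prop) (by fun_prop), ← integral_const_mul]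
    refine integral_congr_ae (Eventually.of_forall fun x ↦ ?_)
    simp only
    rw [mul_pow, Real.sq_sqrt hv]
    ring

/-- The quadratic variation of a linear functional of Brownian motion along uniform grids. -/
lemma IsBrownianMotion.tendstoInMeasure_quadratic_variation (hW : IsBrownianMotion P 𝓕 T W)
    (a : ι → ℝ) {t : ℝ} (ht0 : 0 ≤ t) (htT : t ≤ T) :
    TendstoInMeasure P (fun n ω ↦ (∑ k ∈ Finset.range n,
      (∑ j, a j * (W (unifGrid 0 t n (k + 1)) ω j - W (unifGrid 0 t n k) ω j)) ^ 2)
        - (∑ j, a j ^ 2) * t) atTop (fun _ ↦ 0) := by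
  set q := ∑ j, a j ^ 2 with hq
  have hq0 : 0 ≤ q := Finset.sum_nonneg fun j _ ↦ sq_nonneg _
  set C := ∫ x, (x ^ 2 - 1) ^ 2 ∂gaussianReal 0 1 with hC
  rw [tendstoInMeasure_zero_iff]
  intro ε hε
  have hlim : Tendsto (fun n : ℕ ↦ ENNReal.ofReal (((q * t) ^ 2 * C / ε ^ 2) / n)) atTop (𝓝 0) := by
    rw [← ENNReal.ofReal_zero]
    exact ENNReal.tendsto_ofReal (tendsto_const_div_atTop_nhds_zero_nat _)
  refine tendsto_of_tendsto_of_tendsto_of_le_of_le' tendsto_const_nhds hlim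
    (Eventually.of_forall fun _ ↦ zero_le) ?_
  filter_upwards [eventually_gt_atTop 0] with n hn
  have hn' : (0 : ℝ) < n := by exact_mod_cast hn
  -- The grid is frozen at `t` after `n` steps, giving an infinite monotone sequence of times inside
  -- `[0, T]`.
  set u : ℕ → ℝ := fun p ↦ unifGrid 0 t n (min p n) with hu
  have hum : Monotone u := fun p r hpr ↦ unifGrid_monotone ht0 (by omega)
  have huT : ∀ p, u p ∈ Icc 0 T := fun p ↦
    Icc_subset_Icc_right htT (unifGrid_mem ht0 hn (min_le_right _ _))
  set 𝓖 := sampledFiltration 𝓕 hum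
  set y : ℕ → Ω → ℝ := fun p ω ↦ (∑ j, a j * (W (u (p + 1)) ω j - W (u p) ω j)) ^ 2
    - q * (u (p + 1) - u p) with hy
  have hΔ : ∀ p, 0 ≤ q * (u (p + 1) - u p) := fun p ↦
    mul_nonneg hq0 (sub_nonneg.2 (hum p.le_succ))
  have hlaw : ∀ p, HasLaw (fun ω ↦ ∑ j, a j * (W (u (p + 1)) ω j - W (u p) ω j))
      (gaussianReal 0 (q * (u (p + 1) - u p)).toNNReal) P := fun p ↦
    hW.hasLaw_linear a (huT p).1 (hum p.le_succ) (huT (p + 1)).2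
  have hy2 := fun p ↦ integral_sq_sq_sub_of_hasLaw_gaussianReal (hΔ p) (hlaw p)
  have hkey := integral_sq_sum_transform (P := P) (𝓖 := 𝓖) (c := fun _ _ ↦ 1) (y := y)
    (fun _ ↦ measurable_const) (fun _ ↦ ⟨1, by simp⟩)
    (fun p ↦ ((hW.measurable_linear a (huT p).1 (hum p.le_succ) (huT (p + 1)).2).pow_const
      2).sub_const _)
    (fun p ↦ by
      refine indep_of_indep_of_le_left
        (hW.indep_linear a (huT p).1 (hum p.le_succ) (huT (p + 1)).2) ?_
      have : y p = (fun x : ℝ ↦ x ^ 2 - q * (u (p + 1) - u p))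
        ∘ (fun ω ↦ ∑ j, a j * (W (u (p + 1)) ω j - W (u p) ω j)) := rfl
      rw [this, ← MeasurableSpace.comap_comp]
      exact MeasurableSpace.comap_mono (Measurable.comap_le (by fun_prop)))
    (fun p ↦ (hy2 p).1)
    (fun p ↦ by
      have h2 := (memLp_of_hasLaw_gaussianReal (hlaw p) 2).integrable_sq
      rw [hy]
      simp only
      rw [integral_sub h2 (integrable_const _), integral_sq_of_hasLaw_gaussianReal (hlaw p),
        Real.coe_toNNReal _ (hΔ p)]
      simp) (Finset.range n)
  simp only [one_mul, one_pow, integral_const, probReal_univ, smul_eq_mul, mul_one] at hkey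
  have hcell : ∀ p ∈ Finset.range n, u p = unifGrid 0 t n p ∧ u (p + 1) = unifGrid 0 t n (p + 1) := by
    intro p hp
    have := Finset.mem_range.1 hp
    exact ⟨by rw [hu]; simp only; rw [min_eq_left (by omega)],
      by rw [hu]; simp only; rw [min_eq_left (by omega)]⟩
  have hsum : ∀ ω, ∑ p ∈ Finset.range n, y p ω = (∑ k ∈ Finset.range n,
      (∑ j, a j * (W (unifGrid 0 t n (k + 1)) ω j - W (unifGrid 0 t n k) ω j)) ^ 2) - q * t := by
    intro ω
    have h1 : q * t = ∑ p ∈ Finset.range n, q * (u (p + 1) - u p) := by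
      rw [← Finset.mul_sum, Finset.sum_range_sub]
      simp [hu, unifGrid_last hn]
    rw [h1, ← Finset.sum_sub_distrib]
    refine Finset.sum_congr rfl fun p hp ↦ ?_
    rw [hy]
    simp only
    rw [(hcell p hp).1, (hcell p hp).2]
  -- The centred squares are orthogonal with second moment of order $n^{-2}$, so the sum has
  -- variance of order $1/n$, and Chebyshev's inequality finishes.
  have hval : ∫ ω, (∑ p ∈ Finset.range n, y p ω) ^ 2 ∂P = (q * t) ^ 2 * C / n := by
    rw [hkey.2]
    have : ∀ p ∈ Finset.range n, ∫ ω, y p ω ^ 2 ∂P = (q * (t / n)) ^ 2 * C := by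
      intro p hp
      rw [hy]
      simp only
      rw [(hy2 p).2, (hcell p hp).1, (hcell p hp).2, unifGrid_succ_sub, sub_zero]
    rw [Finset.sum_congr rfl this, Finset.sum_const, Finset.card_range, nsmul_eq_mul]
    field_simp
  have hmarkov := mul_meas_ge_le_integral_of_nonneg
    (Eventually.of_forall fun ω ↦ sq_nonneg (∑ p ∈ Finset.range n, y p ω))
    hkey.1.integrable_sq (ε ^ 2)
  rw [hval] at hmarkov
  calc P {ω | ε ≤ |_ - q * t|}
      ≤ P {ω | ε ^ 2 ≤ (∑ p ∈ Finset.range n, y p ω) ^ 2} := by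
        refine measure_mono fun ω hω ↦ ?_
        rw [mem_ofPred_eq] at hω ⊢
        rw [hsum, ← sq_abs (_ - _)]
        exact pow_le_pow_left₀ hε.le hω 2
    _ ≤ _ := by
        rw [← ofReal_measureReal (by finiteness)]
        refine ENNReal.ofReal_le_ofReal ?_
        rw [div_right_comm, le_div_iff₀ (by positivity)]
        linarith

end Variation

/-- Pathwise bound on the weighted, compensated square integral of an approximation `V` of the
integrand `x v`, where the weights are the reciprocals of `x` at the grid points. -/
lemma tendsto_weighted_sq_integral {x : ℝ → ℝ} {t T v : ℝ} (ht : 0 ≤ t) (htT : t ≤ T)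
    (hx : ContinuousOn x (Icc 0 T)) (hpos : ∀ s ∈ Icc 0 T, 0 < x s) {V : ℕ → ℝ → ℝ}
    (hV : Tendsto (fun n ↦ ∫⁻ s in Icc 0 T, ‖V n s - x s * v‖ₑ ^ 2) atTop (𝓝 0)) :
    Tendsto (fun n ↦ ∑ k ∈ Finset.range n,
      ∫ s in unifGrid 0 t n k..unifGrid 0 t n (k + 1),
        ((x (unifGrid 0 t n k))⁻¹ * V n s - v) ^ 2) atTop (𝓝 0) := by
  have hsub : Icc 0 t ⊆ Icc 0 T := Icc_subset_Icc_right htT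
  obtain ⟨s₀, hs₀, hmin⟩ := isCompact_Icc.exists_isMinOn (nonempty_Icc.2 (ht.trans htT)) hx
  set m := x s₀ with hm
  have hm0 : 0 < m := hpos s₀ hs₀
  have hmx : ∀ s ∈ Icc 0 T, m ≤ x s := fun s hs ↦ hmin hs
  set τ : ℕ → ℕ → ℝ := unifGrid 0 t with hτ
  have hτm : ∀ {n k}, k < n → τ n k ∈ Icc 0 T := fun h ↦ hsub (unifGrid_mem ht (by omega) h.le)
  rw [tendsto_zero_iff_enorm_tendsto_zero, ENNReal.tendsto_nhds_zero]
  intro η hη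
  obtain ⟨η', hη'0, hη'⟩ : ∃ η' : ℝ, 0 < η' ∧ ENNReal.ofReal η' * ENNReal.ofReal t ≤ η / 2 := by
    obtain ⟨r, hr0, hr⟩ := ENNReal.lt_iff_exists_real_btwn.1 (ENNReal.half_pos hη.ne')
    have hr1 : 0 < r := by
      by_contra hc
      rw [ENNReal.ofReal_of_nonpos (not_lt.1 hc)] at hr
      exact lt_irrefl _ hr.1
    refine ⟨r / (t + 1), by positivity, ?_⟩
    rw [← ENNReal.ofReal_mul (by positivity)]
    refine (ENNReal.ofReal_le_ofReal ?_).trans hr.2.le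
    rw [div_mul_eq_mul_div, div_le_iff₀ (by positivity)]
    nlinarith
  -- Dividing by `x ≥ m` leaves a relative oscillation whose square times $2v^2$ is at most `η'`;
  -- the `+ 1` covers `v = 0`.
  have hosc := eventually_unifGrid_osc ht (hx.mono hsub)
    (ε := m * √(η' / (2 * v ^ 2 + 1))) (by positivity)
  have hV' : Tendsto (fun n ↦ ENNReal.ofReal (2 * m⁻¹ ^ 2)
      * ∫⁻ s in Icc 0 T, ‖V n s - x s * v‖ₑ ^ 2) atTop (𝓝 0) := by
    have := ENNReal.Tendsto.const_mul hV (Or.inr (ENNReal.ofReal_ne_top (r := 2 * m⁻¹ ^ 2)))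
    rwa [mul_zero] at this
  filter_upwards [hosc, ENNReal.tendsto_nhds_zero.1 hV' _ (ENNReal.half_pos hη.ne'),
    eventually_gt_atTop 0] with n h1 h2 h3
  have hpt : ∀ k < n, ∀ s ∈ Ioc (τ n k) (τ n (k + 1)),
      ‖((x (τ n k))⁻¹ * V n s - v) ^ 2‖ₑ
        ≤ ENNReal.ofReal (2 * m⁻¹ ^ 2) * ‖V n s - x s * v‖ₑ ^ 2 + ENNReal.ofReal η' := by
    intro k hk s hs
    have h4 := h1 k hk s (Ioc_subset_Icc_self hs)
    have h5 := hpos _ (hτm hk)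
    have h6 : (x (τ n k))⁻¹ ≤ m⁻¹ := inv_anti₀ hm0 (hmx _ (hτm hk))
    have h7 : |(x (τ n k))⁻¹ * x s - 1| ≤ √(η' / (2 * v ^ 2 + 1)) := by
      rw [inv_mul_eq_div, div_sub_one h5.ne', abs_div, abs_of_pos h5, div_le_iff₀ h5]
      refine h4.trans ?_
      rw [mul_comm]
      gcongr
      exact hmx _ (hτm hk)
    have h8 : ((x (τ n k))⁻¹ * x s - 1) ^ 2 * (2 * v ^ 2) ≤ η' := by
      have : ((x (τ n k))⁻¹ * x s - 1) ^ 2 ≤ η' / (2 * v ^ 2 + 1) := by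
        rw [← sq_abs, ← Real.sq_sqrt (show 0 ≤ η' / (2 * v ^ 2 + 1) by positivity)]
        exact pow_le_pow_left₀ (abs_nonneg _) h7 2
      rw [le_div_iff₀ (by positivity)] at this
      nlinarith [sq_nonneg ((x (τ n k))⁻¹ * x s - 1)]
    have h9 : ‖V n s - x s * v‖ₑ ^ 2 = ENNReal.ofReal ((V n s - x s * v) ^ 2) := by
      rw [Real.enorm_eq_ofReal_abs, ← ENNReal.ofReal_pow (abs_nonneg _), sq_abs]
    rw [h9, ← ENNReal.ofReal_mul (by positivity), ← ENNReal.ofReal_add (by positivity) hη'0.le,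
      Real.enorm_eq_ofReal (sq_nonneg _)]
    refine ENNReal.ofReal_le_ofReal ?_
    -- The error splits into the approximation error of `V n` and the freezing of `x` at the left
    -- grid point; then $(p+q)^2\le2p^2+2q^2$.
    have h10 : (x (τ n k))⁻¹ * V n s - v
        = (x (τ n k))⁻¹ * (V n s - x s * v) + ((x (τ n k))⁻¹ * x s - 1) * v := by ring
    have h11 : (x (τ n k))⁻¹ ^ 2 * (V n s - x s * v) ^ 2 ≤ m⁻¹ ^ 2 * (V n s - x s * v) ^ 2 := by
      gcongr
    rw [h10]
    nlinarith [sq_nonneg ((x (τ n k))⁻¹ * (V n s - x s * v) - ((x (τ n k))⁻¹ * x s - 1) * v)]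
  have hmono := unifGrid_monotone (n := n) ht
  have hdisj : (↑(Finset.range n) : Set ℕ).PairwiseDisjoint
      (fun k ↦ Ioc (τ n k) (τ n (k + 1))) :=
    fun k _ l _ hkl ↦ hmono.pairwise_disjoint_on_Ioc_succ hkl
  -- Estimating through `∫⁻` avoids any measurability assumption on `V n`.
  calc ‖∑ k ∈ Finset.range n, ∫ s in τ n k..τ n (k + 1), ((x (τ n k))⁻¹ * V n s - v) ^ 2‖ₑ
      ≤ ∑ k ∈ Finset.range n, ‖∫ s in τ n k..τ n (k + 1), ((x (τ n k))⁻¹ * V n s - v) ^ 2‖ₑ :=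
        enorm_sum_le _ _
    _ ≤ ∑ k ∈ Finset.range n, ∫⁻ s in Ioc (τ n k) (τ n (k + 1)),
        (ENNReal.ofReal (2 * m⁻¹ ^ 2) * ‖V n s - x s * v‖ₑ ^ 2 + ENNReal.ofReal η') := by
        refine Finset.sum_le_sum fun k hk ↦ ?_
        rw [intervalIntegral.integral_of_le (hmono k.le_succ)]
        refine (enorm_integral_le_lintegral_enorm _).trans ?_
        exact setLIntegral_mono' measurableSet_Ioc (hpt k (Finset.mem_range.1 hk))
    _ = ∫⁻ s in ⋃ k ∈ Finset.range n, Ioc (τ n k) (τ n (k + 1)),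
        (ENNReal.ofReal (2 * m⁻¹ ^ 2) * ‖V n s - x s * v‖ₑ ^ 2 + ENNReal.ofReal η') :=
        (lintegral_biUnion_finset hdisj (fun _ _ ↦ measurableSet_Ioc) _).symm
    _ ≤ ∫⁻ s in Ioc 0 t,
        (ENNReal.ofReal (2 * m⁻¹ ^ 2) * ‖V n s - x s * v‖ₑ ^ 2 + ENNReal.ofReal η') := by
        refine lintegral_mono_set (iUnion₂_subset fun k hk ↦ ?_)
        have hk' := Finset.mem_range.1 hk
        exact Ioc_subset_Ioc (unifGrid_mem ht h3 hk'.le).1 (unifGrid_mem ht h3 hk').2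
    _ = (∫⁻ s in Ioc 0 t, ENNReal.ofReal (2 * m⁻¹ ^ 2) * ‖V n s - x s * v‖ₑ ^ 2)
        + ENNReal.ofReal η' * ENNReal.ofReal t := by
        rw [lintegral_add_right _ measurable_const, setLIntegral_const, Real.volume_Ioc, sub_zero]
    _ ≤ η / 2 + η / 2 := by
        gcongr
        rw [lintegral_const_mul' _ _ ENNReal.ofReal_ne_top]
        refine le_trans ?_ h2
        gcongr
        exact Ioc_subset_Icc_self.trans hsub
    _ = η := ENNReal.add_halves η

/-! ### Itô's formula for the logarithm at a fixed time -/

section LogIto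

variable {ι : Type*} [Fintype ι] {P : Measure Ω} [IsProbabilityMeasure P] {𝓕 : Filtration ℝ mΩ}
  {T : ℝ} {W : ℝ → Ω → ι → ℝ}

/-- The relative increments of the Itô integral of `X v` are those of `v W` up to increments `D`
that vanish in the limit together with their quadratic variation. -/
lemma IsItoIntegral.exists_relative_increments (hW : IsBrownianMotion P 𝓕 T W)
    {X I : ℝ → Ω → ℝ} {v : ℝ} {j : ι}
    (hI : IsItoIntegral P 𝓕 T (fun t ω ↦ W t ω j) (fun t ω ↦ X t ω * v) I)
    (hXm : ∀ t ∈ Icc 0 T, Measurable[𝓕 t] (X t))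
    (hXc : ∀ᵐ ω ∂P, ContinuousOn (fun t ↦ X t ω) (Icc 0 T))
    (hXp : ∀ᵐ ω ∂P, ∀ t ∈ Icc 0 T, 0 < X t ω) {t : ℝ} (ht0 : 0 ≤ t) (htT : t ≤ T) :
    ∃ D : ℕ → ℕ → Ω → ℝ,
      TendstoInMeasure P (fun n ω ↦ (∑ k ∈ Finset.range n, D n k ω) ^ 2
        + ∑ k ∈ Finset.range n, D n k ω ^ 2) atTop (fun _ ↦ 0) ∧
      ∀ᵐ ω ∂P, ∃ C : ℝ, ∀ᶠ n : ℕ in atTop, ∀ k < n,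
        |(I (unifGrid 0 t n (k + 1)) ω - I (unifGrid 0 t n k) ω) / X (unifGrid 0 t n k) ω
          - v * (W (unifGrid 0 t n (k + 1)) ω j - W (unifGrid 0 t n k) ω j) - D n k ω|
          ≤ C / (n : ℝ) ^ 2 := by
  obtain ⟨V, hV⟩ := hI.exists_approx_ae
  have hsub : Icc 0 t ⊆ Icc 0 T := Icc_subset_Icc_right htT
  -- The same `n` indexes the approximant and the grid, so that the approximation rate beats the
  -- number of cells.
  set D : ℕ → ℕ → Ω → ℝ := fun n k ω ↦ (X (unifGrid 0 t n k) ω)⁻¹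
      * ((V n).integral (fun s ω ↦ W s ω j) (unifGrid 0 t n (k + 1)) ω
        - (V n).integral (fun s ω ↦ W s ω j) (unifGrid 0 t n k) ω)
      - v * (W (unifGrid 0 t n (k + 1)) ω j - W (unifGrid 0 t n k) ω j) with hD
  set A : ℕ → Ω → ℝ := fun n ω ↦ ∑ k ∈ Finset.range n,
      ∫ s in unifGrid 0 t n k..unifGrid 0 t n (k + 1),
        ((X (unifGrid 0 t n k) ω)⁻¹ * (V n).val s ω - v) ^ 2 with hA
  have hAto : ∀ᵐ ω ∂P, Tendsto (fun n ↦ A n ω) atTop (𝓝 0) := by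
    filter_upwards [hV, hXc, hXp] with ω h1 h2 h3
    exact tendsto_weighted_sq_integral ht0 htT h2 h3 (V := fun n s ↦ (V n).val s ω) h1.1
  have hblock : ∀ n : ℕ, 0 < n → _ := fun n hn ↦
    (V n).measure_block_sums_le hW j ht0 htT hn (w := fun k ω ↦ (X (unifGrid 0 t n k) ω)⁻¹)
      (fun k hk ↦ (hXm _ (hsub (unifGrid_mem ht0 hn hk.le))).inv) v
      (d := D n) (A := A n) (fun _ _ ↦ rfl) (fun _ ↦ rfl)
  have hAmeas : ∀ n, Measurable (A n) := by
    intro n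
    rcases Nat.eq_zero_or_pos n with rfl | hn
    · simp only [hA, Finset.range_zero, Finset.sum_empty]
      exact measurable_const
    · exact (hblock n hn).1
  have hAin : TendstoInMeasure P A atTop (fun _ ↦ 0) :=
    tendstoInMeasure_of_tendsto_ae (fun n ↦ (hAmeas n).aestronglyMeasurable) hAto
  rw [tendstoInMeasure_zero_iff] at hAin
  refine ⟨D, ?_, ?_⟩
  · rw [tendstoInMeasure_zero_iff]
    intro ε hε
    rw [ENNReal.tendsto_nhds_zero]
    intro η hη
    obtain ⟨r, hr0, hr⟩ : ∃ r : ℝ, 0 < r ∧ ENNReal.ofReal r ≤ η / 2 := by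
      obtain ⟨r, hr0, hr⟩ := ENNReal.lt_iff_exists_real_btwn.1 (ENNReal.half_pos hη.ne')
      refine ⟨r, ?_, hr.2.le⟩
      by_contra hc
      rw [ENNReal.ofReal_of_nonpos (not_lt.1 hc)] at hr
      exact lt_irrefl _ hr.1
    -- With this level the Lenglart term $2\delta/\varepsilon$ equals `r`.
    have hδ : 0 < r * ε / 2 := by positivity
    filter_upwards [ENNReal.tendsto_nhds_zero.1 (hAin _ hδ) _ (ENNReal.half_pos hη.ne'),
      eventually_gt_atTop 0] with n h1 h2
    have h3 := (hblock n h2).2 _ hδ ε hε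
    have h4 : 2 * (r * ε / 2) / ε = r := by field_simp
    rw [h4] at h3
    calc _ ≤ P {ω | ε ≤ (∑ k ∈ Finset.range n, D n k ω) ^ 2
          + ∑ k ∈ Finset.range n, D n k ω ^ 2} := by
          refine measure_mono fun ω hω ↦ ?_
          rw [mem_ofPred_eq] at hω ⊢
          rwa [abs_of_nonneg (by positivity)] at hω
      _ ≤ _ := h3
      _ ≤ η / 2 + η / 2 := by
          refine add_le_add ((measure_mono fun ω hω ↦ ?_).trans h1) hr
          rw [mem_ofPred_eq] at hω ⊢
          exact hω.le.trans (le_abs_self _)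
      _ = η := ENNReal.add_halves η
  · filter_upwards [hV, hXc, hXp] with ω h1 h2 h3
    obtain ⟨s₀, hs₀, hmin⟩ := isCompact_Icc.exists_isMinOn (nonempty_Icc.2 (ht0.trans htT)) h2
    refine ⟨(X s₀ ω)⁻¹ * 2, ?_⟩
    filter_upwards [h1.2, eventually_gt_atTop 0] with n h4 h5 k hk
    have hn : (0 : ℝ) < n := by exact_mod_cast h5
    have hk1 := hsub (unifGrid_mem ht0 h5 hk.le)
    have hk2 := hsub (unifGrid_mem ht0 h5 hk)
    have h6 := (h4 _ hk1).le
    have h7 := (h4 _ hk2).le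
    have h8 := h3 _ hk1
    have h9 : 1 / ((n : ℝ) + 1) ^ 2 ≤ 1 / (n : ℝ) ^ 2 := by
      gcongr; linarith
    have h10 : (X (unifGrid 0 t n k) ω)⁻¹ ≤ (X s₀ ω)⁻¹ := inv_anti₀ (h3 _ hs₀) (hmin hk1)
    rw [hD]
    simp only
    set x := X (unifGrid 0 t n k) ω
    set i1 := I (unifGrid 0 t n (k + 1)) ω
    set i0 := I (unifGrid 0 t n k) ω
    set j1 := (V n).integral (fun s ω ↦ W s ω j) (unifGrid 0 t n (k + 1)) ω
    set j0 := (V n).integral (fun s ω ↦ W s ω j) (unifGrid 0 t n k) ω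
    have h11 : (i1 - i0) / x - v * (W (unifGrid 0 t n (k + 1)) ω j - W (unifGrid 0 t n k) ω j)
        - (x⁻¹ * (j1 - j0) - v * (W (unifGrid 0 t n (k + 1)) ω j - W (unifGrid 0 t n k) ω j))
        = x⁻¹ * ((j0 - i0) - (j1 - i1)) := by
      rw [div_eq_inv_mul]; ring
    rw [h11, abs_mul, abs_of_pos (inv_pos.2 h8)]
    have h12 : |(j0 - i0) - (j1 - i1)| ≤ 2 / (n : ℝ) ^ 2 := by
      refine (abs_sub _ _).trans ?_
      have : 2 / (n : ℝ) ^ 2 = 1 / (n : ℝ) ^ 2 + 1 / (n : ℝ) ^ 2 := by ring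
      linarith
    have h13 : 0 ≤ (X s₀ ω)⁻¹ := inv_nonneg.2 (h3 _ hs₀).le
    calc x⁻¹ * |(j0 - i0) - (j1 - i1)| ≤ (X s₀ ω)⁻¹ * (2 / (n : ℝ) ^ 2) := by gcongr
      _ = _ := by ring

/-- Itô's formula for the logarithm of a positive process with constant relative volatility. -/
theorem HasItoDifferential.log_eq (hW : IsBrownianMotion P 𝓕 T W) {X b : ℝ → Ω → ℝ} {v : ι → ℝ}
    (hX : HasItoDifferential P 𝓕 T W X (fun t ω ↦ X t ω * b t ω) (fun j t ω ↦ X t ω * v j))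
    (hXm : ∀ t ∈ Icc 0 T, Measurable[𝓕 t] (X t))
    (hXc : ∀ᵐ ω ∂P, ContinuousOn (fun t ↦ X t ω) (Icc 0 T))
    (hXp : ∀ᵐ ω ∂P, ∀ t ∈ Icc 0 T, 0 < X t ω)
    (hb : ∀ᵐ ω ∂P, ContinuousOn (fun t ↦ b t ω) (Icc 0 T)) {t : ℝ} (ht0 : 0 ≤ t) (htT : t ≤ T) :
    ∀ᵐ ω ∂P, Real.log (X t ω) = Real.log (X 0 ω) + (∫ s in (0 : ℝ)..t, b s ω)
      + (∑ j, v j * (W t ω j - W 0 ω j)) - ((∑ j, v j ^ 2) * t) / 2 := by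
  obtain ⟨_, I, hI, hXI⟩ := hX
  choose D hDin hDerr using fun j ↦ (hI j).exists_relative_increments hW hXm hXc hXp ht0 htT
  -- `none` carries the quadratic variation of $v\cdot W$ and `some j` the error of coordinate `j`,
  -- so that one subsequence serves all of them.
  set f : Option ι → ℕ → Ω → ℝ := fun o ↦ match o with
    | none => fun n ω ↦ (∑ k ∈ Finset.range n,
      (∑ j, v j * (W (unifGrid 0 t n (k + 1)) ω j - W (unifGrid 0 t n k) ω j)) ^ 2)
        - (∑ j, v j ^ 2) * t
    | some j => fun n ω ↦ (∑ k ∈ Finset.range n, D j n k ω) ^ 2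
        + ∑ k ∈ Finset.range n, D j n k ω ^ 2 with hf
  obtain ⟨ν, hν, hlim⟩ := exists_seq_tendsto_ae_finite (P := P) (f := f) (fun o ↦ by
    match o with
    | none => exact hW.tendstoInMeasure_quadratic_variation v ht0 htT
    | some j => exact hDin j)
  filter_upwards [ae_all_iff.2 hlim, ae_all_iff.2 hDerr, hXI, hXc, hXp, hb]
    with ω hlimω herr hXIω hXcω hXpω hbω
  have hsub : Icc 0 t ⊆ Icc 0 T := Icc_subset_Icc_right htT
  have hνt := hν.tendsto_atTop
  set g : ℕ → ℕ → ℝ := fun i k ↦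
    ∑ j, v j * (W (unifGrid 0 t (ν i) (k + 1)) ω j - W (unifGrid 0 t (ν i) k) ω j) with hg
  set e : ι → ℕ → ℕ → ℝ := fun j n k ↦
    (I j (unifGrid 0 t n (k + 1)) ω - I j (unifGrid 0 t n k) ω) / X (unifGrid 0 t n k) ω
      - v j * (W (unifGrid 0 t n (k + 1)) ω j - W (unifGrid 0 t n k) ω j) with he
  have hpair : ∀ j, Tendsto (fun i ↦ ∑ k ∈ Finset.range (ν i), e j (ν i) k) atTop (𝓝 0) ∧
      Tendsto (fun i ↦ ∑ k ∈ Finset.range (ν i), e j (ν i) k ^ 2) atTop (𝓝 0) := by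
    intro j
    obtain ⟨C, hC⟩ := herr j
    have h1 : Tendsto (fun i ↦ (∑ k ∈ Finset.range (ν i), D j (ν i) k ω) ^ 2
        + ∑ k ∈ Finset.range (ν i), D j (ν i) k ω ^ 2) atTop (𝓝 0) := hlimω (some j)
    have h2 : Tendsto (fun i ↦ ∑ k ∈ Finset.range (ν i), D j (ν i) k ω) atTop (𝓝 0) := by
      have h3 : Tendsto (fun i ↦ (∑ k ∈ Finset.range (ν i), D j (ν i) k ω) ^ 2) atTop (𝓝 0) :=
        squeeze_zero (fun i ↦ sq_nonneg _)
          (fun i ↦ le_add_of_nonneg_right (Finset.sum_nonneg fun k _ ↦ sq_nonneg _)) h1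
      have h4 := h3.sqrt
      rw [Real.sqrt_zero] at h4
      exact squeeze_zero_norm (fun i ↦ Real.abs_le_sqrt le_rfl) h4
    have h3 : Tendsto (fun i ↦ ∑ k ∈ Finset.range (ν i), D j (ν i) k ω ^ 2) atTop (𝓝 0) :=
      squeeze_zero (fun i ↦ Finset.sum_nonneg fun k _ ↦ sq_nonneg _)
        (fun i ↦ le_add_of_nonneg_left (sq_nonneg _)) h1
    have h4 : ∀ᶠ i in atTop, ∀ k < ν i, |e j (ν i) k - D j (ν i) k ω| ≤ C / (ν i : ℝ) ^ 2 :=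
      hνt.eventually hC
    have h5 : Tendsto (fun i ↦ C / (ν i : ℝ)) atTop (𝓝 0) :=
      (tendsto_const_div_atTop_nhds_zero_nat C).comp hνt
    have h6 : Tendsto (fun i ↦ ∑ k ∈ Finset.range (ν i), (e j (ν i) k - D j (ν i) k ω)) atTop
        (𝓝 0) := by
      refine squeeze_zero_norm' ?_ h5
      filter_upwards [h4, hνt.eventually (eventually_gt_atTop 0)] with i hi hi0
      have : (0 : ℝ) < ν i := by exact_mod_cast hi0
      calc _ ≤ ∑ k ∈ Finset.range (ν i), C / (ν i : ℝ) ^ 2 :=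
            (norm_sum_le _ _).trans (Finset.sum_le_sum fun k hk ↦ hi k (Finset.mem_range.1 hk))
        _ = C / ν i := by
            rw [Finset.sum_const, Finset.card_range, nsmul_eq_mul]; field_simp
    have h7 : Tendsto (fun i ↦ ∑ k ∈ Finset.range (ν i), (e j (ν i) k - D j (ν i) k ω) ^ 2) atTop
        (𝓝 0) := by
      have h8 := h5.pow 2
      rw [zero_pow two_ne_zero] at h8
      refine squeeze_zero' (Eventually.of_forall fun i ↦ Finset.sum_nonneg fun k _ ↦ sq_nonneg _)
        ?_ h8
      filter_upwards [h4, hνt.eventually (eventually_gt_atTop 0)] with i hi hi0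
      have : (1 : ℝ) ≤ ν i := by exact_mod_cast hi0
      calc _ ≤ ∑ k ∈ Finset.range (ν i), (C / (ν i : ℝ) ^ 2) ^ 2 :=
            Finset.sum_le_sum fun k hk ↦ by
              rw [← sq_abs]
              exact pow_le_pow_left₀ (abs_nonneg _) (hi k (Finset.mem_range.1 hk)) 2
        _ = (C / ν i) ^ 2 * (1 / ν i) := by
            rw [Finset.sum_const, Finset.card_range, nsmul_eq_mul]; field_simp
        _ ≤ (C / ν i) ^ 2 * 1 := by
            gcongr
            rw [div_le_one (by linarith)]; exact this
        _ = (C / ν i) ^ 2 := mul_one _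
    constructor
    · have h8 := h6.add h2
      rw [add_zero] at h8
      refine h8.congr fun i ↦ ?_
      rw [← Finset.sum_add_distrib]
      exact Finset.sum_congr rfl fun k _ ↦ by ring
    · have h8 := (h7.add h3).const_mul 2
      rw [add_zero, mul_zero] at h8
      refine squeeze_zero (fun i ↦ Finset.sum_nonneg fun k _ ↦ sq_nonneg _) (fun i ↦ ?_) h8
      rw [← Finset.sum_add_distrib, Finset.mul_sum]
      refine Finset.sum_le_sum fun k _ ↦ ?_
      nlinarith [sq_nonneg (e j (ν i) k - 2 * D j (ν i) k ω)]
  refine log_eq_of_unifGrid (x := fun s ↦ X s ω) (b := fun s ↦ b s ω)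
    (M := fun s ↦ ∑ j, I j s ω) ht0 (hXcω.mono hsub) (fun s hs ↦ hXpω s (hsub hs))
    (hbω.mono hsub) (fun s hs ↦ hXIω s (hsub hs)) hνt (g := g)
    (d := fun i k ↦ ∑ j, e j (ν i) k) ?_ ?_ ?_ ?_ ?_
  · refine Eventually.of_forall fun i k hk ↦ ?_
    rw [hg, he]
    simp only
    rw [← Finset.sum_add_distrib, ← Finset.sum_sub_distrib, Finset.sum_div]
    exact Finset.sum_congr rfl fun j _ ↦ by ring
  -- Since `v` is constant, the increments of $v\cdot W$ telescope exactly.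
  · refine tendsto_const_nhds.congr' ?_
    filter_upwards [hνt.eventually (eventually_gt_atTop 0)] with i hi
    rw [hg, Finset.sum_comm]
    refine Finset.sum_congr rfl fun j _ ↦ ?_
    rw [← Finset.mul_sum, Finset.sum_range_sub (fun k ↦ W (unifGrid 0 t (ν i) k) ω j),
      unifGrid_zero, unifGrid_last hi]
  · have h1 : Tendsto (fun i ↦ (∑ k ∈ Finset.range (ν i), g i k ^ 2) - (∑ j, v j ^ 2) * t)
        atTop (𝓝 0) := hlimω none
    have h2 := h1.add_const ((∑ j, v j ^ 2) * t)
    simpa using h2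
  · have h1 := tendsto_finsetSum Finset.univ fun j _ ↦ (hpair j).1
    rw [Finset.sum_const_zero] at h1
    exact h1.congr fun i ↦ Finset.sum_comm
  · have h1 := (tendsto_finsetSum Finset.univ fun j _ ↦ (hpair j).2).const_mul
      (Fintype.card ι : ℝ)
    rw [Finset.sum_const_zero, mul_zero] at h1
    refine squeeze_zero (fun i ↦ Finset.sum_nonneg fun k _ ↦ sq_nonneg _) (fun i ↦ ?_) h1
    rw [Finset.sum_comm, Finset.mul_sum]
    refine Finset.sum_le_sum fun k _ ↦ ?_
    exact sq_sum_le_card_mul_sum_sq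

end LogIto

/-! ### Wiener integrals -/

lemma integral_cexp_of_hasLaw_gaussianReal {P : Measure Ω} {y : Ω → ℝ} {v : NNReal}
    (h : HasLaw y (gaussianReal 0 v) P) :
    ∫ ω, Complex.exp ((y ω : ℂ) * Complex.I) ∂P = Complex.exp (-(v : ℂ) / 2) := by
  have h1 : ∫ ω, (fun x : ℝ ↦ Complex.exp ((x : ℂ) * Complex.I)) (y ω) ∂P
      = ∫ x, Complex.exp ((x : ℂ) * Complex.I) ∂gaussianReal 0 v :=
    h.integral_comp (f := fun x : ℝ ↦ Complex.exp ((x : ℂ) * Complex.I)) (by fun_prop)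
  have h2 := charFun_gaussianReal (μ := 0) (v := v) 1
  rw [charFun_apply_real] at h2
  simp only [Complex.ofReal_one, one_mul, Complex.ofReal_zero, zero_mul, zero_sub, one_pow,
    mul_one] at h2
  rw [h1, h2, neg_div]

/-- Each last increment is independent of `Z` and the earlier ones, so the increments peel off one
at a time, each leaving a Gaussian factor. -/
lemma integral_mul_cexp_sum {P : Measure Ω} {𝓖 : Filtration ℕ mΩ} {Z : Ω → ℂ}
    (hZ : Measurable[𝓖 0] Z) {x : ℕ → Ω → ℝ} {q : ℕ → ℝ} (hq : ∀ k, 0 ≤ q k)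
    (hx : ∀ k, Measurable[𝓖 (k + 1)] (x k))
    (hxi : ∀ k, Indep (MeasurableSpace.comap (x k) inferInstance) (𝓖 k) P)
    (hxl : ∀ k, HasLaw (x k) (gaussianReal 0 (q k).toNNReal) P) (n : ℕ) :
    ∫ ω, Z ω * Complex.exp (((∑ k ∈ Finset.range n, x k ω : ℝ) : ℂ) * Complex.I) ∂P
      = (∫ ω, Z ω ∂P) * Complex.exp (-((∑ k ∈ Finset.range n, q k : ℝ) : ℂ) / 2) := by
  have hm : ∀ n, Measurable[𝓖 n] (fun ω ↦ Z ω *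
      Complex.exp (((∑ k ∈ Finset.range n, x k ω : ℝ) : ℂ) * Complex.I)) := by
    intro n
    have h1 : Measurable[𝓖 n] (fun ω ↦ ∑ k ∈ Finset.range n, x k ω) :=
      Finset.measurable_fun_sum _ fun k hk ↦
        (hx k).mono (𝓖.mono (Finset.mem_range.1 hk)) le_rfl
    have h2 : Measurable (fun y : ℝ ↦ Complex.exp ((y : ℂ) * Complex.I)) := by fun_prop
    exact (hZ.mono (𝓖.mono (Nat.zero_le n)) le_rfl).mul (h2.comp h1)
  induction n with
  | zero => simp
  | succ n ih =>
    have hxm : Measurable (x n) := (hx n).mono (𝓖.le _) le_rfl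
    have he : Measurable (fun y : ℝ ↦ Complex.exp ((y : ℂ) * Complex.I)) := by fun_prop
    have hind : IndepFun (fun ω ↦ Z ω *
        Complex.exp (((∑ k ∈ Finset.range n, x k ω : ℝ) : ℂ) * Complex.I))
        (fun ω ↦ Complex.exp ((x n ω : ℂ) * Complex.I)) P := by
      have h1 : IndepFun (fun ω ↦ Z ω *
        Complex.exp (((∑ k ∈ Finset.range n, x k ω : ℝ) : ℂ) * Complex.I)) (x n) P := by
        rw [IndepFun_iff_Indep]
        exact (indep_of_indep_of_le_right (hxi n) (hm n).comap_le).symm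
      exact h1.comp measurable_id he
    have h3 := hind.integral_fun_mul_eq_mul_integral
      ((hm n).mono (𝓖.le _) le_rfl).aestronglyMeasurable (he.comp hxm).aestronglyMeasurable
    rw [ih, integral_cexp_of_hasLaw_gaussianReal (hxl n)] at h3
    have h4 : (((q n).toNNReal : ℝ) : ℂ) = (q n : ℂ) := by rw [Real.coe_toNNReal _ (hq n)]
    rw [Finset.sum_range_succ, mul_assoc] at *
    calc _ = ∫ ω, Z ω * Complex.exp (((∑ k ∈ Finset.range n, x k ω : ℝ) : ℂ) * Complex.I)
          * Complex.exp ((x n ω : ℂ) * Complex.I) ∂P := by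
          refine integral_congr_ae (Eventually.of_forall fun ω ↦ ?_)
          simp only
          rw [mul_assoc, ← Complex.exp_add, Finset.sum_range_succ]
          congr 2
          push_cast; ring
      _ = _ := h3
      _ = _ := by
          rw [← Complex.exp_add]
          congr 2
          rw [h4]
          push_cast; ring

section Wiener

variable {ι κ : Type*} [Fintype ι] {P : Measure Ω} {𝓕 : Filtration ℝ mΩ}
  {T : ℝ} {W : ℝ → Ω → ι → ℝ}

/-- Left Riemann sum of `∫_a^b h dW` on the uniform grid with `n` steps. -/
noncomputable def wienerSum (W : ℝ → Ω → ι → ℝ) (a b : ℝ) (h : ℝ → ι → ℝ) (n : ℕ) (ω : Ω) : ℝ :=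
  ∑ k ∈ Finset.range n, ∑ j, h (unifGrid a b n k) j *
    (W (unifGrid a b n (k + 1)) ω j - W (unifGrid a b n k) ω j)

/-- The Wiener integral `∫_a^b h dW`, as the limit of Riemann sums. -/
noncomputable def wienerIntegral (W : ℝ → Ω → ι → ℝ) (a b : ℝ) (h : ℝ → ι → ℝ) (ω : Ω) : ℝ :=
  limsup (fun n ↦ wienerSum W a b h n ω) atTop

variable {a b : ℝ}

/-- A limsup of `𝓕 b`-measurable sums is `𝓕 b`-measurable everywhere. Hence almost sure convergence
suffices, without completeness of the filtration. -/
lemma IsBrownianMotion.measurable_wienerIntegral (hW : IsBrownianMotion P 𝓕 T W) (ha : 0 ≤ a)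
    (hab : a ≤ b) (hb : b ≤ T) (h : ℝ → ι → ℝ) :
    Measurable[𝓕 b] (wienerIntegral W a b h) := by
  refine Measurable.limsup fun n ↦ ?_
  refine Finset.measurable_fun_sum _ fun k hk ↦ ?_
  have hk' := Finset.mem_range.1 hk
  have h1 := unifGrid_mem hab (by omega) hk'.le
  have h2 := unifGrid_mem hab (by omega) hk'
  exact (hW.measurable_linear _ (ha.trans h1.1) (unifGrid_monotone hab k.le_succ)
    (h2.2.trans hb)).mono (𝓕.mono h2.2) le_rfl

variable [Fintype κ]

/-- The characteristic function of a family of Wiener integrals, given the past. -/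
lemma IsBrownianMotion.setIntegral_cexp_wiener [IsProbabilityMeasure P]
    (hW : IsBrownianMotion P 𝓕 T W) (ha : 0 ≤ a) (hab : a ≤ b)
    (hb : b ≤ T) {h : κ → ℝ → ι → ℝ} (hh : ∀ i j, ContinuousOn (fun s ↦ h i s j) (Icc a b))
    {E : Ω → κ → ℝ}
    (hlim : ∀ᵐ ω ∂P, ∀ i, Tendsto (fun n ↦ wienerSum W a b (h i) n ω) atTop (𝓝 (E ω i)))
    (u : κ → ℝ) {A : Set Ω} (hA : MeasurableSet[𝓕 a] A) :
    ∫ ω in A, Complex.exp (((∑ i, u i * E ω i : ℝ) : ℂ) * Complex.I) ∂P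
      = P.real A * Complex.exp
        (-((∫ s in a..b, ∑ j, (∑ i, u i * h i s j) ^ 2 : ℝ) : ℂ) / 2) := by
  -- Carrying the indicator of a past event yields the law and the independence of the past from one
  -- formula.
  set Z : Ω → ℂ := A.indicator fun _ ↦ 1 with hZ
  have hAm : MeasurableSet A := 𝓕.le a A hA
  have hf : ContinuousOn (fun s ↦ ∑ j, (∑ i, u i * h i s j) ^ 2) (Icc a b) :=
    continuousOn_finsetSum _ fun j _ ↦
      (continuousOn_finsetSum _ fun i _ ↦ (continuousOn_const.mul (hh i j))).pow 2
  have hfin : ∀ n : ℕ, 0 < n →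
      ∫ ω, Z ω * Complex.exp (((∑ i, u i * wienerSum W a b (h i) n ω : ℝ) : ℂ) * Complex.I) ∂P
      = (∫ ω, Z ω ∂P) * Complex.exp (-((∑ k ∈ Finset.range n,
        (∑ j, (∑ i, u i * h i (unifGrid a b n k) j) ^ 2) * ((b - a) / n) : ℝ) : ℂ) / 2) := by
    intro n hn
    set τ : ℕ → ℝ := fun k ↦ unifGrid a b n (min k n) with hτ
    have hτm : Monotone τ := fun p r hpr ↦ unifGrid_monotone hab (by omega)
    have hτT : ∀ p, τ p ∈ Icc a b := fun p ↦ unifGrid_mem hab hn (min_le_right _ _)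
    have hcell : ∀ p ∈ Finset.range n,
        τ p = unifGrid a b n p ∧ τ (p + 1) = unifGrid a b n (p + 1) := by
      intro p hp
      have := Finset.mem_range.1 hp
      exact ⟨by rw [hτ]; simp only; rw [min_eq_left (by omega)],
        by rw [hτ]; simp only; rw [min_eq_left (by omega)]⟩
    have hp0 : ∀ p, 0 ≤ τ p := fun p ↦ ha.trans (hτT p).1
    have hpT : ∀ p, τ p ≤ T := fun p ↦ (hτT p).2.trans hb
    have hτ0 : τ 0 = a := by simp [hτ]
    have key := integral_mul_cexp_sum (P := P) (𝓖 := sampledFiltration 𝓕 hτm) (Z := Z)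
      (by
        have : Measurable[𝓕 a] Z := measurable_const.indicator hA
        rw [← hτ0] at this
        exact this)
      (x := fun k ω ↦ ∑ j, (∑ i, u i * h i (τ k) j) * (W (τ (k + 1)) ω j - W (τ k) ω j))
      (q := fun k ↦ (∑ j, (∑ i, u i * h i (τ k) j) ^ 2) * (τ (k + 1) - τ k))
      (fun k ↦ mul_nonneg (Finset.sum_nonneg fun j _ ↦ sq_nonneg _)
        (sub_nonneg.2 (hτm k.le_succ)))
      (fun k ↦ hW.measurable_linear _ (hp0 k) (hτm k.le_succ) (hpT _))
      (fun k ↦ hW.indep_linear _ (hp0 k) (hτm k.le_succ) (hpT _))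
      (fun k ↦ hW.hasLaw_linear _ (hp0 k) (hτm k.le_succ) (hpT _)) n
    have e1 : ∀ ω, ∑ i, u i * wienerSum W a b (h i) n ω = ∑ k ∈ Finset.range n,
        ∑ j, (∑ i, u i * h i (τ k) j) * (W (τ (k + 1)) ω j - W (τ k) ω j) := by
      intro ω
      unfold wienerSum
      simp_rw [Finset.mul_sum, Finset.sum_mul]
      rw [Finset.sum_comm]
      refine Finset.sum_congr rfl fun k hk ↦ ?_
      rw [Finset.sum_comm, (hcell k hk).1, (hcell k hk).2]
      exact Finset.sum_congr rfl fun j _ ↦ Finset.sum_congr rfl fun i _ ↦ by ring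
    have e2 : ∑ k ∈ Finset.range n,
        (∑ j, (∑ i, u i * h i (unifGrid a b n k) j) ^ 2) * ((b - a) / n)
        = ∑ k ∈ Finset.range n, (∑ j, (∑ i, u i * h i (τ k) j) ^ 2) * (τ (k + 1) - τ k) := by
      refine Finset.sum_congr rfl fun k hk ↦ ?_
      rw [(hcell k hk).1, (hcell k hk).2, unifGrid_succ_sub]
    simp_rw [e1]
    rw [e2]
    exact key
  have hZint : ∫ ω, Z ω ∂P = P.real A := by
    rw [hZ, integral_indicator hAm]
    simp
  have hset : ∀ Y : Ω → ℂ, ∫ ω in A, Y ω ∂P = ∫ ω, Z ω * Y ω ∂P := by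
    intro Y
    rw [← integral_indicator hAm]
    refine integral_congr_ae (Eventually.of_forall fun ω ↦ ?_)
    by_cases hω : ω ∈ A <;> simp [hZ, hω]
  have hexp : Continuous fun y : ℝ ↦ Complex.exp ((y : ℂ) * Complex.I) := by fun_prop
  have hsum_meas : ∀ n, Measurable fun ω ↦ ∑ i, u i * wienerSum W a b (h i) n ω := by
    intro n
    refine Finset.measurable_fun_sum _ fun i _ ↦ Measurable.const_mul ?_ _
    refine Finset.measurable_fun_sum _ fun k hk ↦ ?_
    have hk' := Finset.mem_range.1 hk
    have h1 := unifGrid_mem hab (by omega) hk'.le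
    have h2 := unifGrid_mem hab (by omega) hk'
    exact (hW.measurable_linear _ (ha.trans h1.1) (unifGrid_monotone hab k.le_succ)
      (h2.2.trans hb)).mono (𝓕.le _) le_rfl
  have hZm : Measurable Z := measurable_const.indicator hAm
  have hlhs : Tendsto (fun n ↦ ∫ ω, Z ω *
      Complex.exp (((∑ i, u i * wienerSum W a b (h i) n ω : ℝ) : ℂ) * Complex.I) ∂P) atTop
      (𝓝 (∫ ω, Z ω * Complex.exp (((∑ i, u i * E ω i : ℝ) : ℂ) * Complex.I) ∂P)) := by
    refine tendsto_integral_of_dominated_convergence (fun _ ↦ 1) (fun n ↦ ?_)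
      (integrable_const _) (fun n ↦ Eventually.of_forall fun ω ↦ ?_) ?_
    · exact (hZm.mul (hexp.measurable.comp (hsum_meas n))).aestronglyMeasurable
    · rw [norm_mul, Complex.norm_exp_ofReal_mul_I, mul_one, hZ]
      by_cases hω : ω ∈ A <;> simp [hω]
    · filter_upwards [hlim] with ω hω
      refine Tendsto.const_mul _ ((hexp.tendsto _).comp ?_)
      exact tendsto_finsetSum _ fun i _ ↦ (hω i).const_mul _
  have hexp2 : Continuous fun y : ℝ ↦ Complex.exp (-(y : ℂ) / 2) := by fun_prop
  have hrhs := ((hexp2.tendsto _).comp (tendsto_riemann_sum hab hf)).const_mul (∫ ω, Z ω ∂P)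
  rw [hset, ← hZint]
  refine tendsto_nhds_unique hlhs (hrhs.congr' ?_)
  filter_upwards [eventually_gt_atTop 0] with n hn
  exact (hfin n hn).symm

/-- A family of Wiener integrals is jointly Gaussian and centred, independent of the past, with
covariances given by Itô's isometry. -/
theorem IsBrownianMotion.wiener_gaussian [IsProbabilityMeasure P]
    (hW : IsBrownianMotion P 𝓕 T W) (ha : 0 ≤ a) (hab : a ≤ b)
    (hb : b ≤ T) {h : κ → ℝ → ι → ℝ} (hh : ∀ i j, ContinuousOn (fun s ↦ h i s j) (Icc a b))
    {E : Ω → κ → ℝ} (hE : Measurable E)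
    (hlim : ∀ᵐ ω ∂P, ∀ i, Tendsto (fun n ↦ wienerSum W a b (h i) n ω) atTop (𝓝 (E ω i))) :
    HasGaussianLaw E P ∧ Indep (MeasurableSpace.comap E inferInstance) (𝓕 a) P ∧
      (∀ i, ∫ ω, E ω i ∂P = 0) ∧
      ∀ i l, ∫ ω, E ω i * E ω l ∂P = ∫ s in a..b, ∑ j, h i s j * h l s j := by
  classical
  have hchar := fun u A hA ↦ hW.setIntegral_cexp_wiener ha hab hb hh hlim u (A := A) hA
  set Q : (κ → ℝ) → ℝ := fun u ↦ ∫ s in a..b, ∑ j, (∑ i, u i * h i s j) ^ 2 with hQ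
  have hQ0 : ∀ u, 0 ≤ Q u := fun u ↦
    intervalIntegral.integral_nonneg hab fun s _ ↦ Finset.sum_nonneg fun j _ ↦ sq_nonneg _
  have hEm : ∀ u : κ → ℝ, Measurable fun ω ↦ ∑ i, u i * E ω i := by
    intro u; fun_prop
  have hlaw : ∀ u : κ → ℝ, HasLaw (fun ω ↦ ∑ i, u i * E ω i) (gaussianReal 0 (Q u).toNNReal) P := by
    intro u
    refine ⟨(hEm u).aemeasurable, ?_⟩
    have : IsProbabilityMeasure (P.map fun ω ↦ ∑ i, u i * E ω i) :=
      Measure.isProbabilityMeasure_map (hEm u).aemeasurable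
    refine Measure.ext_of_charFun (funext fun r ↦ ?_)
    rw [charFun_gaussianReal, charFun_apply_real, integral_map (hEm u).aemeasurable (by fun_prop)]
    have h1 := hchar (fun i ↦ r * u i) univ MeasurableSet.univ
    have h2 : Q (fun i ↦ r * u i) = r ^ 2 * Q u := by
      simp only [hQ]
      rw [← intervalIntegral.integral_const_mul]
      congr 1; ext s
      rw [Finset.mul_sum]
      refine Finset.sum_congr rfl fun j _ ↦ ?_
      rw [← mul_pow, Finset.mul_sum]
      congr 1
      exact Finset.sum_congr rfl fun i _ ↦ by ring
    change _ = _ * Complex.exp (-((Q (fun i ↦ r * u i) : ℝ) : ℂ) / 2) at h1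
    rw [h2, Measure.restrict_univ, probReal_univ] at h1
    have h3 : (((Q u).toNNReal : ℝ) : ℂ) = (Q u : ℂ) := by rw [Real.coe_toNNReal _ (hQ0 u)]
    rw [h3]
    convert h1 using 2
    · ext ω
      congr 2
      push_cast
      rw [Finset.mul_sum]
      exact Finset.sum_congr rfl fun i _ ↦ by ring
    · push_cast
      rw [one_mul]
      congr 1
      ring
  have hdual : ∀ (L : StrongDual ℝ (κ → ℝ)) (x : κ → ℝ),
      L x = ∑ i, L (Pi.single i 1) * x i := by
    intro L x
    conv_lhs => rw [← Finset.univ_sum_single x, map_sum]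
    refine Finset.sum_congr rfl fun i _ ↦ ?_
    have : Pi.single i (x i) = x i • (Pi.single i 1 : κ → ℝ) := by
      rw [← Pi.single_smul, smul_eq_mul, mul_one]
    rw [this, map_smul, smul_eq_mul, mul_comm]
  refine ⟨⟨isGaussian_of_map_eq_gaussianReal fun L ↦ ⟨0, (Q fun i ↦ L (Pi.single i 1)).toNNReal,
    ?_⟩⟩, ?_, ?_, ?_⟩
  · rw [Measure.map_map (by fun_prop) hE, ← (hlaw fun i ↦ L (Pi.single i 1)).map_eq]
    congr 1
    ext ω
    exact hdual L (E ω)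
  · rw [Indep_iff]
    rintro _ A ⟨B, hB, rfl⟩ hA
    have hAm : MeasurableSet A := 𝓕.le a A hA
    -- Restricting to a past event only rescales the characteristic function, hence the law; this is
    -- independence.
    have hmap : (P.restrict A).map E = (P A) • P.map E := by
      have : IsFiniteMeasure ((P A) • P.map E) := Measure.smul_finite _ (measure_ne_top P A)
      refine Measure.ext_of_charFunDual (funext fun L ↦ ?_)
      rw [charFunDual_apply, charFunDual_apply, integral_smul_measure,
        integral_map hE.aemeasurable (by fun_prop), integral_map hE.aemeasurable (by fun_prop)]
      have h1 := hchar (fun i ↦ L (Pi.single i 1)) A hA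
      have h2 := hchar (fun i ↦ L (Pi.single i 1)) univ MeasurableSet.univ
      simp_rw [← hdual] at h1 h2
      rw [Measure.restrict_univ, probReal_univ, Complex.ofReal_one, one_mul] at h2
      rw [h1, h2, Complex.real_smul]
      rfl
    have h3 := congrArg (fun μ ↦ μ B) hmap
    simp only [Measure.smul_apply, smul_eq_mul] at h3
    rw [Measure.map_apply hE hB, Measure.map_apply hE hB, Measure.restrict_apply (hE hB)] at h3
    rw [h3, mul_comm]
  · intro i
    have := integral_of_hasLaw_gaussianReal (hlaw (Pi.single i 1))
    simpa [Pi.single_apply] using this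
  · intro i l
    have hE2 : ∀ i, MemLp (fun ω ↦ E ω i) 2 P := by
      intro i
      have := memLp_of_hasLaw_gaussianReal (hlaw (Pi.single i 1)) 2
      simpa [Pi.single_apply] using this
    have hsq : ∀ u : κ → ℝ, ∫ ω, (∑ i, u i * E ω i) ^ 2 ∂P = Q u := fun u ↦ by
      rw [integral_sq_of_hasLaw_gaussianReal (hlaw u), Real.coe_toNNReal _ (hQ0 u)]
    -- Polarisation: the covariance comes from the variances of $E_i\pm E_l$.
    have h1 := hsq (Pi.single i 1 + Pi.single l 1)
    have h2 := hsq (Pi.single i 1 - Pi.single l 1)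
    simp only [hQ, Pi.add_apply, Pi.sub_apply, Pi.single_apply, add_mul, sub_mul, ite_mul, one_mul,
      zero_mul, Finset.sum_add_distrib, Finset.sum_sub_distrib, Finset.sum_ite_eq',
      Finset.mem_univ, if_true] at h1 h2
    have h3 : ∫ ω, E ω i * E ω l ∂P
        = ((∫ ω, (E ω i + E ω l) ^ 2 ∂P) - ∫ ω, (E ω i - E ω l) ^ 2 ∂P) / 4 := by
      have i1 : Integrable (fun ω ↦ (E ω i + E ω l) ^ 2) P := ((hE2 i).add (hE2 l)).integrable_sq
      have i2 : Integrable (fun ω ↦ (E ω i - E ω l) ^ 2) P := ((hE2 i).sub (hE2 l)).integrable_sq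
      rw [← integral_sub i1 i2, ← integral_div]
      refine integral_congr_ae (Eventually.of_forall fun ω ↦ ?_)
      simp only
      ring
    have hcont : ∀ c : ℝ, IntervalIntegrable (fun s ↦ ∑ j, (h i s j + c * h l s j) ^ 2)
        volume a b := by
      intro c
      have : ContinuousOn (fun s ↦ ∑ j, (h i s j + c * h l s j) ^ 2) (Icc a b) :=
        continuousOn_finsetSum _ fun j _ ↦
          ((hh i j).add (continuousOn_const.mul (hh l j))).pow 2
      rw [← uIcc_of_le hab] at this
      exact this.intervalIntegrable
    have hc1 := hcont 1
    have hc2 := hcont (-1)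
    simp only [one_mul, neg_mul, ← sub_eq_add_neg] at hc1 hc2
    rw [h3, h1, h2, ← intervalIntegral.integral_sub hc1 hc2, ← intervalIntegral.integral_div]
    congr 1; ext s
    rw [← Finset.sum_sub_distrib, Finset.sum_div]
    exact Finset.sum_congr rfl fun j _ ↦ by ring

end Wiener

/-- Random variables that are, one after the other, independent of the past are independent. -/
lemma iIndepFun_of_indep_past {P : Measure Ω} [IsProbabilityMeasure P] {κ β : Type*}
    [LinearOrder κ] [mβ : MeasurableSpace β] {f : κ → Ω → β} {past : κ → MeasurableSpace Ω}
    (hf : ∀ k l, k < l → Measurable[past l] (f k))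
    (hi : ∀ k, Indep (MeasurableSpace.comap (f k) inferInstance) (past k) P) : iIndepFun f P := by
  classical
  rw [iIndepFun_iff_measure_inter_preimage_eq_mul]
  intro S
  -- The largest index is split off: the events of all smaller ones lie in its past.
  induction S using Finset.induction_on_max with
  | empty => intro sets _; simp
  | insert k s hlt ih =>
    intro sets hs
    have hk : k ∉ s := fun h ↦ lt_irrefl _ (hlt k h)
    rw [Finset.prod_insert hk, ← ih fun i hi ↦ hs i (Finset.mem_insert_of_mem hi),
      Finset.set_biInter_insert]
    refine (Indep_iff _ _ _).1 (hi k) _ _ ⟨_, hs k (Finset.mem_insert_self _ _), rfl⟩ ?_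
    exact MeasurableSet.biInter s.countable_toSet fun l hl ↦
      hf l k (hlt l hl) (hs l (Finset.mem_insert_of_mem hl))

/-! ### The log-prices and the log-basis -/

/-- The exceptional sets are collected over a countable dense set of times, and continuity does the
rest. -/
lemma ae_forall_eq_of_continuousOn {P : Measure Ω} {T : ℝ} {f g : ℝ → Ω → ℝ}
    (hf : ∀ᵐ ω ∂P, ContinuousOn (fun t ↦ f t ω) (Icc 0 T))
    (hg : ∀ᵐ ω ∂P, ContinuousOn (fun t ↦ g t ω) (Icc 0 T))
    (h : ∀ t ∈ Icc 0 T, ∀ᵐ ω ∂P, f t ω = g t ω) :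
    ∀ᵐ ω ∂P, ∀ t ∈ Icc 0 T, f t ω = g t ω := by
  obtain ⟨s, hs, hsd⟩ := TopologicalSpace.exists_countable_dense (Icc (0 : ℝ) T)
  have h1 : ∀ᵐ ω ∂P, ∀ t ∈ s, f t ω = g t ω := (ae_ball_iff hs).2 fun t _ ↦ h t t.2
  filter_upwards [hf, hg, h1] with ω hfω hgω h1ω t ht
  have := Continuous.ext_on hsd (continuousOn_iff_continuous_domRestrict.1 hfω)
    (continuousOn_iff_continuous_domRestrict.1 hgω) (fun t ht ↦ h1ω t ht)
  exact congrFun this ⟨t, ht⟩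

lemma continuousOn_primitive_Icc {f : ℝ → ℝ} {T : ℝ} (hf : ContinuousOn f (Icc 0 T)) :
    ContinuousOn (fun t ↦ ∫ s in (0 : ℝ)..t, f s) (Icc 0 T) := by
  rcases lt_or_ge T 0 with hT | hT
  · simp [Icc_eq_empty_of_lt hT]
  rw [← uIcc_of_le hT] at *
  exact intervalIntegral.continuousOn_primitive_interval hf.integrableOn_uIcc

/-- Itô's formula for the logarithm, simultaneously for all times. -/
theorem HasItoDifferential.log_eq_forall {ι : Type*} [Fintype ι] {P : Measure Ω}
    [IsProbabilityMeasure P] {𝓕 : Filtration ℝ mΩ} {T : ℝ} {W : ℝ → Ω → ι → ℝ}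
    (hW : IsBrownianMotion P 𝓕 T W) {X b : ℝ → Ω → ℝ} {v : ι → ℝ}
    (hX : HasItoDifferential P 𝓕 T W X (fun t ω ↦ X t ω * b t ω) (fun j t ω ↦ X t ω * v j))
    (hXm : ∀ t ∈ Icc 0 T, Measurable[𝓕 t] (X t))
    (hXc : ∀ᵐ ω ∂P, ContinuousOn (fun t ↦ X t ω) (Icc 0 T))
    (hXp : ∀ᵐ ω ∂P, ∀ t ∈ Icc 0 T, 0 < X t ω)
    (hb : ∀ᵐ ω ∂P, ContinuousOn (fun t ↦ b t ω) (Icc 0 T)) :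
    ∀ᵐ ω ∂P, ∀ t ∈ Icc 0 T, Real.log (X t ω) = Real.log (X 0 ω) + (∫ s in (0 : ℝ)..t, b s ω)
      + (∑ j, v j * (W t ω j - W 0 ω j)) - ((∑ j, v j ^ 2) * t) / 2 := by
  refine ae_forall_eq_of_continuousOn ?_ ?_ fun t ht ↦ hX.log_eq hW hXm hXc hXp hb ht.1 ht.2
  · filter_upwards [hXc, hXp] with ω h1 h2
    exact h1.log fun t ht ↦ (h2 t ht).ne'
  · filter_upwards [hb, hW.continuous] with ω h1 h2
    have h3 : ∀ j, ContinuousOn (fun t ↦ W t ω j) (Icc 0 T) := fun j ↦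
      (continuous_apply j).comp_continuousOn h2
    exact ((continuousOn_const.add (continuousOn_primitive_Icc h1)).add
      (continuousOn_finsetSum _ fun j _ ↦ continuousOn_const.mul
        ((h3 j).sub continuousOn_const))).sub
      ((continuousOn_const.mul continuousOn_id).div_const 2)

/-- Variation of constants for a mean-reverting path. -/
lemma mul_sub_mul_of_linear {z G k ρ : ℝ → ℝ} {T m a b : ℝ}
    (hz : ContinuousOn z (Icc 0 T)) (hG : ContinuousOn G (Icc 0 T)) (hk : ContinuousOn k (Icc 0 T))
    (hρ : ∀ s ∈ Icc 0 T, HasDerivAt ρ (k s * ρ s) s)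
    (h : ∀ t ∈ Icc 0 T, z t = z 0 + (∫ s in (0 : ℝ)..t, (m - k s * z s)) + G t)
    (ha : 0 ≤ a) (hab : a ≤ b) (hb : b ≤ T) :
    ρ b * z b = ρ a * z a + (∫ s in a..b, ρ s) * m
      + (ρ b * G b - ρ a * G a - ∫ s in a..b, G s * (k s * ρ s)) := by
  have hsub : Icc a b ⊆ Icc 0 T := Icc_subset_Icc ha hb
  have hf : ContinuousOn (fun s ↦ m - k s * z s) (Icc 0 T) := continuousOn_const.sub (hk.mul hz)
  have hρc : ContinuousOn ρ (Icc 0 T) := fun s hs ↦ (hρ s hs).continuousAt.continuousWithinAt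
  have hint : ∀ {f : ℝ → ℝ}, ContinuousOn f (Icc 0 T) → IntervalIntegrable f volume a b := by
    intro f hf
    have := hf.mono hsub
    rw [← uIcc_of_le hab] at this
    exact this.intervalIntegrable
  have hi1 := hint hρc
  have hi2 : IntervalIntegrable (fun s ↦ G s * (k s * ρ s)) volume a b :=
    hint (hG.mul (hk.mul hρc))
  -- The noise `G` is merely continuous, but `z - G` is differentiable; multiplying by the
  -- integrating factor `ρ` cancels the terms in `z`.
  have hder : ∀ s ∈ Ioo a b, HasDerivAt (fun t ↦ ρ t * (z t - G t))
      (ρ s * m - G s * (k s * ρ s)) s := by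
    intro s hs
    have hs' : s ∈ Icc 0 T := hsub (Ioo_subset_Icc_self hs)
    have hs0 : s ∈ Ioo 0 T := ⟨ha.trans_lt hs.1, hs.2.trans_le hb⟩
    have hprim : HasDerivAt (fun t ↦ ∫ r in (0 : ℝ)..t, (m - k r * z r)) (m - k s * z s) s := by
      refine intervalIntegral.integral_hasDerivAt_right ?_ ?_ ?_
      · have := hf.mono (Icc_subset_Icc_right hs'.2)
        rw [← uIcc_of_le hs'.1] at this
        exact this.intervalIntegrable
      · exact (hf.mono Ioo_subset_Icc_self).stronglyMeasurableAtFilter isOpen_Ioo s hs0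
      · exact hf.continuousAt (Icc_mem_nhds hs0.1 hs0.2)
    have hzG : HasDerivAt (fun t ↦ z t - G t) (m - k s * z s) s := by
      refine (hprim.const_add (z 0)).congr_of_eventuallyEq ?_
      filter_upwards [Icc_mem_nhds hs0.1 hs0.2] with t ht
      rw [h t ht]; ring
    exact ((hρ s hs').mul hzG).congr_deriv (by ring)
  have hftc := intervalIntegral.integral_eq_sub_of_hasDerivAt_of_le hab
    ((hρc.mul (hz.sub hG)).mono hsub) hder ((hi1.mul_const m).sub hi2)
  rw [intervalIntegral.integral_sub (hi1.mul_const m) hi2,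
    intervalIntegral.integral_mul_const] at hftc
  simp only [Pi.mul_apply, Pi.sub_apply] at hftc
  linarith

/-! ### The scaling factor, its integrals and the covariance entries -/

namespace Params

variable {N : ℕ} (p : Params N)

lemma expiry_pos (i : Fin N) : 0 < p.expiry i := p.T_pos.trans (p.T_lt_expiry i)

lemma expiry_sub_pos (i : Fin N) {s : ℝ} (hs : s ≤ p.T) : 0 < p.expiry i - s := by
  have := p.T_lt_expiry i
  linarith

lemma scale_eq (i : Fin N) {s : ℝ} (hs : s ≤ p.T) :
    p.scale i s = p.expiry i ^ p.kappa i * (p.expiry i - s) ^ (-p.kappa i) := by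
  unfold scale
  rw [Real.div_rpow (p.expiry_pos i).le (p.expiry_sub_pos i hs).le,
    Real.rpow_neg (p.expiry_sub_pos i hs).le, div_eq_mul_inv]

lemma hasDerivAt_scale (i : Fin N) {s : ℝ} (hs : s ≤ p.T) :
    HasDerivAt (p.scale i) (p.kappa i / (p.expiry i - s) * p.scale i s) s := by
  have h0 := p.expiry_sub_pos i hs
  have h1 : HasDerivAt (fun t ↦ p.expiry i / (p.expiry i - t))
      (p.expiry i / (p.expiry i - s) ^ 2) s := by
    refine ((hasDerivAt_const s (p.expiry i)).div ((hasDerivAt_id' s).const_sub _)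
      h0.ne').congr_deriv ?_
    ring
  have h2 := p.expiry_pos i
  have h3 : p.expiry i / (p.expiry i - s) ≠ 0 := (div_pos h2 h0).ne'
  have h4 := h1.rpow_const (p := p.kappa i) (Or.inl h3)
  unfold scale
  convert h4 using 1
  rw [Real.rpow_sub_one h3]
  field_simp

lemma continuousOn_scale (i : Fin N) : ContinuousOn (p.scale i) (Iic p.T) := fun _ hs ↦
  (p.hasDerivAt_scale i hs).continuousAt.continuousWithinAt

lemma grid_nonneg (M n : ℕ) : 0 ≤ p.grid M n := by
  have := p.T_pos
  unfold grid; positivity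

lemma grid_mono (M : ℕ) : Monotone (p.grid M) := by
  intro k l hkl
  have h1 : (k : ℝ) ≤ l := by exact_mod_cast hkl
  have := p.T_pos
  unfold grid; gcongr

lemma grid_le {M n : ℕ} (hM : 0 < M) (hn : n ≤ M) : p.grid M n ≤ p.T := by
  have h1 : (n : ℝ) ≤ M := by exact_mod_cast hn
  have h2 : (0 : ℝ) < M := by exact_mod_cast hM
  have := p.T_pos
  unfold grid
  rw [div_le_iff₀ h2, mul_comm]
  gcongr

lemma grid_sub {M n : ℕ} (hn : 1 ≤ n) : p.grid M n - p.grid M (n - 1) = p.T / M := by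
  unfold grid
  rw [Nat.cast_sub hn]
  push_cast; ring

/-- An explicit antiderivative of the scaling factor; `phi` distinguishes $\kappa_i=1$ because there
it is a logarithm. -/
lemma integral_scale {M n : ℕ} (hM : 0 < M) (hn : n ≤ M) (i : Fin N) :
    ∫ s in p.grid M (n - 1)..p.grid M n, p.scale i s = p.phi M n i := by
  set a := p.grid M (n - 1)
  set b := p.grid M n
  have hab : a ≤ b := p.grid_mono M (by omega)
  have hb : b ≤ p.T := p.grid_le hM hn
  have hs : ∀ s ∈ uIcc a b, s ≤ p.T := fun s hs ↦ by
    rw [uIcc_of_le hab] at hs; exact hs.2.trans hb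
  have hi : IntervalIntegrable (p.scale i) volume a b :=
    ((p.continuousOn_scale i).mono hs).intervalIntegrable
  have ha0 := p.expiry_sub_pos i (hab.trans hb)
  have hb0 := p.expiry_sub_pos i hb
  unfold phi
  split_ifs with hk
  · rw [intervalIntegral.integral_eq_sub_of_hasDerivAt
      (f := fun s ↦ -(p.expiry i * Real.log (p.expiry i - s))) _ hi]
    · rw [Real.log_div ha0.ne' hb0.ne']
      ring
    · intro s hsm
      have h0 := p.expiry_sub_pos i (hs s hsm)
      refine ((((hasDerivAt_id' s).const_sub (p.expiry i)).log h0.ne').const_mul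
        (p.expiry i)).neg.congr_deriv ?_
      rw [scale, hk, Real.rpow_one]
      ring
  · rw [intervalIntegral.integral_eq_sub_of_hasDerivAt
      (f := fun s ↦ p.expiry i ^ p.kappa i / (p.kappa i - 1)
        * (p.expiry i - s) ^ (1 - p.kappa i)) _ hi]
    · ring
    · intro s hsm
      have h0 := p.expiry_sub_pos i (hs s hsm)
      refine ((((hasDerivAt_id' s).const_sub (p.expiry i)).rpow_const (p := 1 - p.kappa i)
        (Or.inl h0.ne')).const_mul (p.expiry i ^ p.kappa i / (p.kappa i - 1))).congr_deriv ?_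
      rw [p.scale_eq i (hs s hsm)]
      have h2 : p.kappa i - 1 ≠ 0 := sub_ne_zero.2 hk
      have h3 : 1 - p.kappa i - 1 = -p.kappa i := by ring
      rw [h3]
      field_simp
      ring

lemma volF_sq (i : Fin N) : p.volF i ^ 2 = ∑ j, p.vol (.inl i) j ^ 2 := by
  have h : p.cov (.inl i) (.inl i) = ∑ j, p.vol (.inl i) j ^ 2 := by
    simp [cov, Matrix.mul_apply, sq]
  rw [volF, h, Real.sq_sqrt (Finset.sum_nonneg fun j _ ↦ sq_nonneg _)]

lemma volS_sq (i : Fin N) : p.volS i ^ 2 = ∑ j, p.vol (.inr i) j ^ 2 := by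
  have h : p.cov (.inr i) (.inr i) = ∑ j, p.vol (.inr i) j ^ 2 := by
    simp [cov, Matrix.mul_apply, sq]
  rw [volS, h, Real.sq_sqrt (Finset.sum_nonneg fun j _ ↦ sq_nonneg _)]

lemma volZ_apply (i : Fin N) (j : Fin N ⊕ Fin N) :
    p.volZ i j = p.vol (.inl i) j - p.vol (.inr i) j := by
  have h : p.volZ i j
      = ∑ l, Matrix.fromCols (1 : Matrix (Fin N) (Fin N) ℝ) (-1) i l * p.vol l j := rfl
  rw [h, Fintype.sum_sum_type]
  simp [Matrix.one_apply, sub_eq_add_neg]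

lemma covS_apply (i l : Fin N) : p.covS i l = ∑ j, p.vol (.inr i) j * p.vol (.inr l) j := by
  simp [covS, cov, Matrix.toBlocks₂₂, Matrix.mul_apply]

lemma covZ_apply (i l : Fin N) : p.covZ i l = ∑ j, p.volZ i j * p.volZ l j := by
  simp [covZ, Matrix.mul_apply]

/-- The rows of $\tilde\Sigma_Z$ are futures rows minus asset rows of $\tilde\Sigma$, so this is the
covariance rate between the noises of $\ln S_i$ and $Z_l$. -/
lemma covFS_transpose_sub_covS_apply (i l : Fin N) :
    (p.covFSᵀ - p.covS) i l = ∑ j, p.vol (.inr i) j * p.volZ l j := by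
  simp only [Matrix.sub_apply, Matrix.transpose_apply, covS_apply, volZ_apply, mul_sub,
    Finset.sum_sub_distrib]
  congr 1
  simp [covFS, cov, Matrix.toBlocks₁₂, Matrix.mul_apply, mul_comm]

end Params

/-! ### The log-prices and the log-basis of the market -/

namespace Params

variable {N : ℕ} (p : Params N)

lemma continuousOn_logBasis {F S : ℝ → Ω → Fin N → ℝ} {ω : Ω}
    (hF : ContinuousOn (fun t ↦ F t ω) (Icc 0 p.T)) (hS : ContinuousOn (fun t ↦ S t ω) (Icc 0 p.T))
    (hFp : ∀ t ∈ Icc 0 p.T, ∀ i, 0 < F t ω i) (hSp : ∀ t ∈ Icc 0 p.T, ∀ i, 0 < S t ω i)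
    (i : Fin N) : ContinuousOn (fun t ↦ p.logBasis F S t ω i) (Icc 0 p.T) := by
  have h1 := (continuous_apply i).comp_continuousOn hF
  have h2 := (continuous_apply i).comp_continuousOn hS
  exact ((h1.div h2 fun t ht ↦ (hSp t ht i).ne').log
    fun t ht ↦ (div_pos (hFp t ht i) (hSp t ht i)).ne').sub
    (continuousOn_const.mul (continuousOn_const.sub continuousOn_id))

lemma continuousOn_div_expiry_sub (c : ℝ) (i : Fin N) :
    ContinuousOn (fun s ↦ c / (p.expiry i - s)) (Icc 0 p.T) :=
  continuousOn_const.div (continuousOn_const.sub continuousOn_id)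
    fun _ hs ↦ (p.expiry_sub_pos i hs.2).ne'

lemma logBasis_eq {F S : ℝ → Ω → Fin N → ℝ} {t : ℝ} {ω : Ω} {i : Fin N} (hF : 0 < F t ω i)
    (hS : 0 < S t ω i) :
    p.logBasis F S t ω i
      = Real.log (F t ω i) - Real.log (S t ω i) - p.r * (p.expiry i - t) := by
  rw [logBasis, Real.log_div hF.ne' hS.ne']

variable {P : Measure Ω} [IsProbabilityMeasure P] {𝓕 : Filtration ℝ mΩ}
  {W : ℝ → Ω → Fin N ⊕ Fin N → ℝ} {F S : ℝ → Ω → Fin N → ℝ} {p}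

/-- The log-prices and the log-basis solve linear stochastic differential equations. -/
lemma IsMarket.log_eq (hW : IsBrownianMotion P 𝓕 p.T W) (hFS : p.IsMarket P 𝓕 W F S)
    (hetaS : ∀ i, p.etaS i = 0) :
    ∀ᵐ ω ∂P, ∀ i, ∀ t ∈ Icc 0 p.T,
      Real.log (S t ω i) = Real.log (S 0 ω i) + p.logDriftS i * t
        + ∑ j, p.vol (.inr i) j * (W t ω j - W 0 ω j) ∧
      p.logBasis F S t ω i = p.logBasis F S 0 ω i
        + (∫ s in (0 : ℝ)..t, (p.m i - p.kappa i / (p.expiry i - s) * p.logBasis F S s ω i))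
        + ∑ j, p.volZ i j * (W t ω j - W 0 ω j) := by
  have hZc : ∀ᵐ ω ∂P, ∀ i, ContinuousOn (fun t ↦ p.logBasis F S t ω i) (Icc 0 p.T) := by
    filter_upwards [hFS.continuous_F, hFS.continuous_S, hFS.pos_F, hFS.pos_S] with ω h1 h2 h3 h4 i
    exact p.continuousOn_logBasis h1 h2 h3 h4 i
  have hdrift : ∀ (μ η : ℝ) (i : Fin N), ∀ᵐ ω ∂P, ContinuousOn
      (fun t ↦ μ + η / (p.expiry i - t) * p.logBasis F S t ω i) (Icc 0 p.T) := by
    intro μ η i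
    filter_upwards [hZc] with ω h
    exact continuousOn_const.add ((p.continuousOn_div_expiry_sub η i).mul (h i))
  have hlogF : ∀ i, _ := fun i ↦ (hFS.sde_F i).log_eq_forall hW
    (fun t ht ↦ (measurable_pi_apply i).comp (hFS.adapted_F t ht))
    (hFS.continuous_F.mono fun ω h ↦ (continuous_apply i).comp_continuousOn h)
    (hFS.pos_F.mono fun ω h t ht ↦ h t ht i) (hdrift (p.muF i) (p.etaF i) i)
  have hlogS : ∀ i, _ := fun i ↦ (hFS.sde_S i).log_eq_forall hW
    (fun t ht ↦ (measurable_pi_apply i).comp (hFS.adapted_S t ht))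
    (hFS.continuous_S.mono fun ω h ↦ (continuous_apply i).comp_continuousOn h)
    (hFS.pos_S.mono fun ω h t ht ↦ h t ht i) (hdrift (p.muS i) (p.etaS i) i)
  filter_upwards [ae_all_iff.2 hlogF, ae_all_iff.2 hlogS, hFS.pos_F, hFS.pos_S, hZc]
    with ω hF hS hFp hSp hZ i t ht
  have h0 : (0 : ℝ) ∈ Icc 0 p.T := ⟨le_rfl, p.T_pos.le⟩
  have hF' := hF i t ht
  have hS' := hS i t ht
  rw [← p.volF_sq] at hF'
  rw [← p.volS_sq] at hS'
  have hcont : ∀ c, IntervalIntegrable (fun s ↦ c / (p.expiry i - s) * p.logBasis F S s ω i)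
      volume 0 t := by
    intro c
    have := ((p.continuousOn_div_expiry_sub c i).mul (hZ i)).mono (Icc_subset_Icc_right ht.2)
    rw [← uIcc_of_le ht.1] at this
    exact this.intervalIntegrable
  -- All drifts are expressed through the single integral of $Z_i/(T_i-s)$, so subtracting the
  -- log-prices becomes linear algebra.
  have hint : ∀ μ c : ℝ, ∫ s in (0 : ℝ)..t, (μ + c / (p.expiry i - s) * p.logBasis F S s ω i)
      = μ * t + c * ∫ s in (0 : ℝ)..t, p.logBasis F S s ω i / (p.expiry i - s) := by
    intro μ c
    rw [intervalIntegral.integral_add intervalIntegrable_const (hcont c),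
      intervalIntegral.integral_const, ← intervalIntegral.integral_const_mul, smul_eq_mul,
      sub_zero, mul_comm t μ]
    congr 2; ext s; ring
  rw [hint] at hF' hS'
  rw [hetaS, zero_mul, add_zero] at hS'
  constructor
  · rw [hS', logDriftS]; ring
  · have e1 : ∫ s in (0 : ℝ)..t, (p.m i - p.kappa i / (p.expiry i - s) * p.logBasis F S s ω i)
        = p.m i * t + -p.kappa i * ∫ s in (0 : ℝ)..t, p.logBasis F S s ω i / (p.expiry i - s) := by
      rw [← hint]
      congr 1; ext s; ring
    rw [e1, p.logBasis_eq (hFp t ht i) (hSp t ht i), p.logBasis_eq (hFp 0 h0 i) (hSp 0 h0 i),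
      hF', hS']
    simp_rw [volZ_apply, sub_mul]
    rw [Finset.sum_sub_distrib, kappa, hetaS, m]
    ring

end Params

/-- Convergence of the Riemann sums of a Wiener integral with a differentiable integrand. -/
lemma tendsto_wienerSum {ι : Type*} [Fintype ι] {W : ℝ → Ω → ι → ℝ} {T a b : ℝ} {ω : Ω}
    (hWc : ContinuousOn (fun t ↦ W t ω) (Icc 0 T)) {ρ k : ℝ → ℝ} (v : ι → ℝ)
    (hk : ContinuousOn k (Icc 0 T)) (hρ : ∀ s ∈ Icc 0 T, HasDerivAt ρ (k s * ρ s) s)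
    (ha : 0 ≤ a) (hab : a ≤ b) (hb : b ≤ T) :
    Tendsto (fun n ↦ wienerSum W a b (fun s j ↦ ρ s * v j) n ω) atTop
      (𝓝 (ρ b * (∑ j, v j * (W b ω j - W 0 ω j)) - ρ a * (∑ j, v j * (W a ω j - W 0 ω j))
        - ∫ s in a..b, (∑ j, v j * (W s ω j - W 0 ω j)) * (k s * ρ s))) := by
  have hsub : Icc a b ⊆ Icc 0 T := Icc_subset_Icc ha hb
  have hρc : ContinuousOn ρ (Icc 0 T) := fun s hs ↦ (hρ s hs).continuousAt.continuousWithinAt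
  have hG : ContinuousOn (fun s ↦ ∑ j, v j * (W s ω j - W 0 ω j)) (Icc 0 T) :=
    continuousOn_finsetSum _ fun j _ ↦ continuousOn_const.mul
      (((continuous_apply j).comp_continuousOn hWc).sub continuousOn_const)
  refine (tendsto_riemann_stieltjes_sum hab (h := ρ) (fun s hs ↦ hρ s (hsub hs))
    ((hk.mul hρc).mono hsub) (hG.mono hsub)).congr fun n ↦ ?_
  refine Finset.sum_congr rfl fun i _ ↦ ?_
  rw [← Finset.sum_sub_distrib, Finset.mul_sum]
  exact Finset.sum_congr rfl fun j _ ↦ by ring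

end BasisModel

/-! ### The recursion for the market -/

theorem mainTheorem5 {N : ℕ} (p : BasisModel.Params N) (hetaS : ∀ i, p.etaS i = 0)
    {Ω : Type*} {mΩ : MeasurableSpace Ω} (P : Measure Ω) [IsProbabilityMeasure P]
    (𝓕 : Filtration ℝ mΩ) (W : ℝ → Ω → Fin N ⊕ Fin N → ℝ)
    (hW : BasisModel.IsBrownianMotion P 𝓕 p.T W)
    (F S : ℝ → Ω → Fin N → ℝ) (hFS : p.IsMarket P 𝓕 W F S)
    (Z : ℝ → Ω → Fin N → ℝ) (hZ : Z = p.logBasis F S)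
    (M : ℕ) (hM : 0 < M) :
    ∃ eS eZ : ℕ → Ω → Fin N → ℝ,
      -- the recursion for `log S`, the scaled log-basis and `log F`
      (∀ n ∈ Icc 1 M, ∀ᵐ ω ∂P, ∀ i,
        Real.log (S (p.grid M n) ω i)
            = Real.log (S (p.grid M (n - 1)) ω i) + p.T / M * p.logDriftS i + eS n ω i ∧
        p.scale i (p.grid M n) * Z (p.grid M n) ω i
            = p.scale i (p.grid M (n - 1)) * Z (p.grid M (n - 1)) ω i
              + p.phi M n i * p.m i + eZ n ω i ∧
        Real.log (F (p.grid M n) ω i)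
            = Z (p.grid M n) ω i + Real.log (S (p.grid M n) ω i)
              + p.r * (p.expiry i - p.grid M n)) ∧
      -- the errors are jointly Gaussian in each step and independent across steps
      (∀ n ∈ Icc 1 M, Measurable (eS n) ∧ Measurable (eZ n) ∧
        HasGaussianLaw (fun ω ↦ Sum.elim (eS n ω) (eZ n ω)) P) ∧
      iIndepFun (fun (n : Icc 1 M) ω ↦ Sum.elim (eS n ω) (eZ n ω)) P ∧
      -- the errors of each step are independent of the past
      (∀ n ∈ Icc 1 M,
        Indep (MeasurableSpace.comap (fun ω ↦ Sum.elim (eS n ω) (eZ n ω)) inferInstance)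
          (𝓕 (p.grid M (n - 1))) P) ∧
      -- means and covariance blocks
      (∀ n ∈ Icc 1 M, ∀ i, ∫ ω, eS n ω i ∂P = 0 ∧ ∫ ω, eZ n ω i ∂P = 0) ∧
      (∀ n ∈ Icc 1 M, ∀ i j,
        ∫ ω, eS n ω i * eS n ω j ∂P = ((p.T / M) • p.covS) i j ∧
        ∫ ω, eS n ω i * eZ n ω j ∂P
          = ((p.covFSᵀ - p.covS) * Matrix.diagonal (p.phi M n)) i j ∧
        ∫ ω, eZ n ω i * eZ n ω j ∂P = p.etaCov M n i j) := by
  subst hZ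
  -- The log-prices (`inl`) are treated as a case without mean reversion, $\rho=1$ and $k=0$, so
  -- both error blocks form one family of Wiener integrals and joint Gaussianity comes at once.
  set ρ : Fin N ⊕ Fin N → ℝ → ℝ := Sum.elim (fun _ _ ↦ 1) p.scale
  set k : Fin N ⊕ Fin N → ℝ → ℝ :=
    Sum.elim (fun _ _ ↦ 0) (fun i s ↦ p.kappa i / (p.expiry i - s))
  set v : Fin N ⊕ Fin N → Fin N ⊕ Fin N → ℝ :=
    Sum.elim (fun i j ↦ p.vol (.inr i) j) (fun i j ↦ p.volZ i j)
  have hρl : ∀ i s, ρ (.inl i) s = 1 := fun _ _ ↦ rfl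
  have hρr : ∀ i s, ρ (.inr i) s = p.scale i s := fun _ _ ↦ rfl
  have hkl : ∀ i s, k (.inl i) s = 0 := fun _ _ ↦ rfl
  have hkr : ∀ i s, k (.inr i) s = p.kappa i / (p.expiry i - s) := fun _ _ ↦ rfl
  have hvl : ∀ i j, v (.inl i) j = p.vol (.inr i) j := fun _ _ ↦ rfl
  have hvr : ∀ i j, v (.inr i) j = p.volZ i j := fun _ _ ↦ rfl
  have hρ : ∀ q, ∀ s ∈ Icc 0 p.T, HasDerivAt (ρ q) (k q s * ρ q s) s := by
    rintro (i | i) s hs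
    · exact (hasDerivAt_const s (1 : ℝ)).congr_deriv (by rw [hkl, zero_mul])
    · exact p.hasDerivAt_scale i hs.2
  have hk : ∀ q, ContinuousOn (k q) (Icc 0 p.T) := by
    rintro (i | i)
    · exact continuousOn_const
    · exact p.continuousOn_div_expiry_sub _ i
  have hρc : ∀ q, ContinuousOn (ρ q) (Icc 0 p.T) := fun q s hs ↦
    (hρ q s hs).continuousAt.continuousWithinAt
  set E : ℕ → Ω → Fin N ⊕ Fin N → ℝ := fun n ω q ↦
    BasisModel.wienerIntegral W (p.grid M (n - 1)) (p.grid M n) (fun s j ↦ ρ q s * v q j) ω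
  have h0a : ∀ n, 0 ≤ p.grid M (n - 1) := fun n ↦ p.grid_nonneg M _
  have hab : ∀ n, p.grid M (n - 1) ≤ p.grid M n := fun n ↦ p.grid_mono M (by omega)
  have hbT : ∀ n ∈ Icc 1 M, p.grid M n ≤ p.T := fun n hn ↦ p.grid_le hM hn.2
  have hEadapted : ∀ n ∈ Icc 1 M, Measurable[𝓕 (p.grid M n)] (E n) := fun n hn ↦
    @measurable_pi_lambda Ω _ _ (𝓕 (p.grid M n)) _ (E n) fun q ↦
      hW.measurable_wienerIntegral (h0a n) (hab n) (hbT n hn) _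
  have hEm : ∀ n ∈ Icc 1 M, Measurable (E n) := fun n hn ↦ (hEadapted n hn).mono (𝓕.le _) le_rfl
  have hlim : ∀ n ∈ Icc 1 M, ∀ᵐ ω ∂P, ∀ q, _ := fun n hn ↦ hW.continuous.mono fun ω hω q ↦
    BasisModel.tendsto_wienerSum hω (v q) (hk q) (hρ q) (h0a n) (hab n) (hbT n hn)
  have hlim' : ∀ n ∈ Icc 1 M, ∀ᵐ ω ∂P, ∀ q, Tendsto (fun l ↦
      BasisModel.wienerSum W (p.grid M (n - 1)) (p.grid M n) (fun s j ↦ ρ q s * v q j) l ω) atTop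
      (𝓝 (E n ω q)) := fun n hn ↦ (hlim n hn).mono fun ω hω q ↦ by
    have h1 : E n ω q = _ := (hω q).limsup_eq
    rw [h1]
    exact hω q
  have hgauss : ∀ n ∈ Icc 1 M, _ := fun n hn ↦
    hW.wiener_gaussian (h0a n) (hab n) (hbT n hn) (h := fun q s j ↦ ρ q s * v q j)
      (fun q j ↦ ((hρc q).mono (Icc_subset_Icc (h0a n) (hbT n hn))).mul continuousOn_const)
      (hEm n hn) (hlim' n hn)
  -- The volatilities are constant and leave the integral. What remains is $\int1=T/M$,
  -- $\int\rho_i=\phi_{n,i}$ or $\int\rho_i\rho_j$ for the three blocks.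
  have hcov : ∀ n ∈ Icc 1 M, ∀ q r, ∫ ω, E n ω q * E n ω r ∂P
      = (∑ j, v q j * v r j) * ∫ s in p.grid M (n - 1)..p.grid M n, ρ q s * ρ r s := by
    intro n hn q r
    rw [(hgauss n hn).2.2.2 q r, ← intervalIntegral.integral_const_mul]
    congr 1; ext s
    rw [Finset.sum_mul]
    exact Finset.sum_congr rfl fun j _ ↦ by ring
  have helim : ∀ n, (fun ω ↦ Sum.elim (fun i ↦ E n ω (.inl i)) (fun i ↦ E n ω (.inr i))) = E n := by
    intro n
    ext ω (i | i) <;> rfl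
  refine ⟨fun n ω i ↦ E n ω (.inl i), fun n ω i ↦ E n ω (.inr i), ?_, ?_, ?_, ?_, ?_, ?_⟩
  · intro n hn
    have hgridT : ∀ l ≤ n, p.grid M l ∈ Icc 0 p.T := fun l hl ↦
      ⟨p.grid_nonneg M l, (p.grid_mono M hl).trans (hbT n hn)⟩
    have hn1 := hgridT (n - 1) (by omega)
    have hn0 := hgridT n le_rfl
    filter_upwards [hFS.log_eq hW hetaS, hlim n hn, hFS.continuous_F, hFS.continuous_S,
      hFS.pos_F, hFS.pos_S, hW.continuous] with ω hlog hω hFc hSc hFp hSp hWc i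
    have hGc : ContinuousOn (fun s ↦ ∑ j, p.volZ i j * (W s ω j - W 0 ω j)) (Icc 0 p.T) :=
      continuousOn_finsetSum _ fun j _ ↦ continuousOn_const.mul
        (((continuous_apply j).comp_continuousOn hWc).sub continuousOn_const)
    refine ⟨?_, ?_, ?_⟩
    · have hE : E n ω (.inl i) = _ := (hω (.inl i)).limsup_eq
      simp only [hE, hρl, hkl, hvl, one_mul, zero_mul, mul_zero,
        intervalIntegral.integral_zero, sub_zero]
      rw [(hlog i _ hn0).1, (hlog i _ hn1).1, ← p.grid_sub hn.1]
      ring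
    · have hE : E n ω (.inr i) = _ := (hω (.inr i)).limsup_eq
      have hlin := BasisModel.mul_sub_mul_of_linear
        (p.continuousOn_logBasis hFc hSc hFp hSp i) hGc (hk (.inr i)) (hρ (.inr i))
        (fun t ht ↦ (hlog i t ht).2) (h0a n) (hab n) (hbT n hn)
      simp only [hρr, hkr, hvr] at hlin hE
      rw [p.integral_scale hM hn.2] at hlin
      rw [hlin, hE]
    · rw [p.logBasis_eq (hFp _ hn0 i) (hSp _ hn0 i)]
      ring
  · intro n hn
    refine ⟨?_, ?_, ?_⟩
    · exact measurable_pi_lambda _ fun i ↦ measurable_pi_iff.1 (hEm n hn) (.inl i)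
    · exact measurable_pi_lambda _ fun i ↦ measurable_pi_iff.1 (hEm n hn) (.inr i)
    · rw [helim]
      exact (hgauss n hn).1
  · have hfun : (fun (n : Icc 1 M) ω ↦
        Sum.elim (fun i ↦ E n ω (.inl i)) (fun i ↦ E n ω (.inr i))) = fun n : Icc 1 M ↦ E n :=
      funext fun n ↦ helim n
    rw [hfun]
    -- The error of an earlier step `l` is known at `p.grid M l`, which is at most `p.grid M (n -
    -- 1)` when `l < n`.
    refine BasisModel.iIndepFun_of_indep_past
      (past := fun n : Icc 1 M ↦ 𝓕 (p.grid M ((n : ℕ) - 1))) ?_ fun n ↦ (hgauss n n.2).2.1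
    intro l n hln
    have hln' : (l : ℕ) < n := hln
    exact (hEadapted l l.2).mono (𝓕.mono (p.grid_mono M (by omega))) le_rfl
  · intro n hn
    rw [helim]
    exact (hgauss n hn).2.1
  · exact fun n hn i ↦ ⟨(hgauss n hn).2.2.1 _, (hgauss n hn).2.2.1 _⟩
  · intro n hn i j
    refine ⟨?_, ?_, ?_⟩
    · rw [hcov n hn, Matrix.smul_apply, p.covS_apply, ← p.grid_sub hn.1]
      simp only [hρl, hvl, mul_one, intervalIntegral.integral_const, smul_eq_mul]
      ring
    · rw [hcov n hn, Matrix.mul_diagonal, p.covFS_transpose_sub_covS_apply,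
        ← p.integral_scale hM hn.2]
      simp only [hρl, hρr, hvl, hvr, one_mul]
    · rw [hcov n hn, BasisModel.Params.etaCov, Matrix.of_apply, p.covZ_apply]
      simp only [hρr, hvr]
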